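/- Let $k$ be an algebraically closed field of characteristic $0$, $R=k[X_1,\dots,X_r]$, and let $R$ act on $\mathcal D=k[x_1,\dots,x_r]$ as differential operators ($X_i$ acts as $\partial/\partial x_i$). For a homogeneous ideal $I\subset R$ with $A=R/I=\bigoplus_d A_d$ Artinian and $j$ the largest degree with $A_j\neq 0$, $A$ is \emph{level} if its socle $\{a\in A: aA_1=0\}$ equals $A_j$; its \emph{type} is then $\dim_k A_j$, and it has \emph{codimension} $r$ if $I$ contains no nonzero form of degree $0$ or $1$. It is \emph{non-unimodal} if there is no $0\le i\le j$ such that $d\mapsto \dim_k A_d$ is nondecreasing on $\{0,\dots,i\}$ and nonincreasing on $\{i,\dots,j\}$. For a list $K=(K_1,\dots,K_n)$ of non-negative integers, $n\le r$, let $M_K(d)$ be the set of multi-indexes $D\in\mathbb Z_{\ge 0}^r$ of degree $d$ with $D_l\le K_l$ for $1\le l\le n$, and $m_K(d)=\#M_K(d)$. Given $r,j,P,Q,s$ and coefficient vectors $C\in k^{s\,m_P(j)}$, $C'\in k^{m_Q(j)}$, let $\mathcal E(C)$ be the span of the $s$ forms $\sum_{J\in M_P(j)}C_{mJ}x^J$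 ($1\le m\le s$), let $\mathcal F(C')$ be the span of the form $\sum_{J\in M_Q(j)}C'_Jx^J$, and let $A(C,C')=R/\mathrm{Ann}_R(\mathcal E(C)+\mathcal F(C'))$. Consider the following families of algebras $A(C,C')$, in each of which $s$ is required to satisfy $s\cdot m_P(j-i-3)\ge m_P(i+3)$: * $F_1(a,i,s)$: $r=3$, $j=i+a$, $P=(a-1)$, $Q=(j,j,j)$, where $a\ge 4$, $i\ge 2a$; * $G_1(a,b,i,s)$: $r=4$, $j=i+ab$, $P=(a-1,b-1)$, $Q=(j,j,j,0)$, where $b\ge a\ge 2$, $i\ge ab+1$; * $H_1(a,b,c,i,s)$: $r=5$, $j=i+abc$, $P=(a-1,b-1,c-1)$, $Q=(j,j,j,0,0)$, where $c\ge b\ge a\ge 2$, $i\ge abc$. \textbf{Proposition.} In codimension $3$ there exist non-unimodal level algebras of every type $t\ge 5$. In codimension $4$ and in codimension $5$ there exist non-unimodal level algebras of every type $t\ge 3$. More precisely, for every such $t$ there are permitted parameters of the family $F_1$ (codimension $3$), $G_1$ (codimension $4$), $H_1$ (codimension $5$), respectively, such that for general $(C,C')$, that is, for all $(C,C')$ in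 a dense Zariski-open subset of the affine space of coefficients, $A(C,C')$ is a non-unimodal level algebra of that codimension and of type $t$. -/

import Mathlib

namespace LevelAlg

noncomputable section

/-! ### Graded quotients of polynomial rings, level algebras, Hilbert functions -/

section Quotients

variable {k : Type*} [Field k] {r : ℕ}

/-- The degree `d` piece `A_d` (the image of the forms of degree `d`) of the quotient
`A = k[X_1, …, X_r] / I`. -/
def gradedPiece (I : Ideal (MvPolynomial (Fin r) k)) (d : ℕ) :
    Submodule k (MvPolynomial (Fin r) k ⧸ I) :=
  (MvPolynomial.homogeneousSubmodule (Fin r) k d).map (Ideal.Quotient.mkₐ k I).toLinearMap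

/-- The Hilbert function `d ↦ dim_k A_d` of `A = k[X_1, …, X_r] / I`. -/
def hilbertFunction (I : Ideal (MvPolynomial (Fin r) k)) (d : ℕ) : ℕ :=
  Module.finrank k (gradedPiece I d)

/-- The socle `{a ∈ A | a A_1 = 0}` of `A = k[X_1, …, X_r] / I`. -/
def socle (I : Ideal (MvPolynomial (Fin r) k)) :
    Submodule k (MvPolynomial (Fin r) k ⧸ I) where
  carrier := {a | ∀ b ∈ gradedPiece I 1, a * b = 0}
  add_mem' := by
    intro a a' ha ha' b hb
    rw [add_mul, ha b hb, ha' b hb, add_zero]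
  zero_mem' := by
    intro b _
    exact zero_mul b
  smul_mem' := by
    intro c a ha b hb
    rw [smul_mul_assoc, ha b hb, smul_zero]

/-- `A = k[X_1, …, X_r] / I` is a graded Artinian quotient, `j` is the largest degree in which it
is nonzero, and it is level (of socle degree `j`): its socle is `A_j`. -/
structure IsLevel (I : Ideal (MvPolynomial (Fin r) k)) (j : ℕ) : Prop where
  homogeneous : ∀ F ∈ I, ∀ d, MvPolynomial.homogeneousComponent d F ∈ I
  artinian : Module.Finite k (MvPolynomial (Fin r) k ⧸ I)
  top_ne_bot : gradedPiece I j ≠ ⊥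
  eq_bot_of_gt : ∀ d, j < d → gradedPiece I d = ⊥
  socle_eq : socle I = gradedPiece I j

/-- `I` contains no nonzero constant or linear forms; this is what it means that the codimension
of `k[X_1, …, X_r] / I` is `r`, the number of variables. -/
def HasCodimEqNumVars (I : Ideal (MvPolynomial (Fin r) k)) : Prop :=
  ∀ d ≤ 1, ∀ F ∈ I, F.IsHomogeneous d → F = 0

/-- A function `h` on `{0, …, j}` is unimodal. -/
def Unimodal (h : ℕ → ℕ) (j : ℕ) : Prop :=
  ∃ i ≤ j, MonotoneOn h (Set.Icc 0 i) ∧ AntitoneOn h (Set.Icc i j)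

/-- `k[X_1, …, X_r] / I` is a non-unimodal level algebra of codimension `r` and type `t`. -/
def IsNonUnimodalLevel (r : ℕ) (I : Ideal (MvPolynomial (Fin r) k)) (t : ℕ) : Prop :=
  HasCodimEqNumVars I ∧
    ∃ j, IsLevel I j ∧ hilbertFunction I j = t ∧ ¬ Unimodal (hilbertFunction I) j

end Quotients

/-! ### Polynomials acting as differential operators -/

section Action

variable (k : Type*) [Field k] (r : ℕ)

/-- The partial derivative `∂ / ∂x_i` as a `k`-linear endomorphism of `k[x_1, …, x_r]`. -/
def partialDeriv (i : Fin r) : Module.End k (MvPolynomial (Fin r) k) :=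
  (MvPolynomial.pderiv i).toLinearMap

theorem partialDeriv_commute (i j : Fin r) :
    Commute (partialDeriv k r i) (partialDeriv k r j) := by
  have h : ⁅(MvPolynomial.pderiv i :
        Derivation k (MvPolynomial (Fin r) k) (MvPolynomial (Fin r) k)),
      (MvPolynomial.pderiv j :
        Derivation k (MvPolynomial (Fin r) k) (MvPolynomial (Fin r) k))⁆ = 0 := by
    apply MvPolynomial.derivation_ext
    intro l
    rw [Derivation.commutator_apply]
    by_cases hi : i = l <;> by_cases hj : j = l <;>
      simp [MvPolynomial.pderiv_X, hi, hj]
  apply LinearMap.ext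
  intro f
  have h2 := congrArg (fun D => D f) h
  simp only [Derivation.commutator_apply, Derivation.zero_apply] at h2
  exact sub_eq_zero.mp h2

theorem partialDeriv_pow_pairwise (D : Fin r →₀ ℕ) :
    ((Finset.univ : Finset (Fin r)) : Set (Fin r)).Pairwise
      (Function.onFun Commute fun i => partialDeriv k r i ^ D i) :=
  fun i _ j _ _ => (partialDeriv_commute k r i j).pow_pow _ _

/-- The differential operator `∏_i (∂ / ∂x_i) ^ (D_i)` by which the monomial `X^D` acts. -/
def monomialAction (D : Fin r →₀ ℕ) : Module.End k (MvPolynomial (Fin r) k) :=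
  Finset.univ.noncommProd (fun i => partialDeriv k r i ^ D i)
    (partialDeriv_pow_pairwise k r D)

theorem monomialAction_zero : monomialAction k r 0 = 1 := by
  unfold monomialAction
  rw [Finset.noncommProd_eq_pow_card _ _ _ 1 (by intro i _; simp)]
  simp

theorem monomialAction_add (D E : Fin r →₀ ℕ) :
    monomialAction k r (D + E) = monomialAction k r D * monomialAction k r E := by
  unfold monomialAction
  rw [← Finset.noncommProd_mul_distrib _ _ _ _
    (fun i _ j _ _ => (partialDeriv_commute k r i j).pow_pow _ _)]
  apply Finset.noncommProd_congr rfl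
  intro i _
  simp [pow_add]

/-- The action `F ↦ (f ↦ F * f)` of `R = k[X_1, …, X_r]` on `k[x_1, …, x_r]` as differential
operators: the `k`-algebra map which sends `X^D` to `∏_i (∂ / ∂x_i) ^ (D_i)`. -/
def diffAction : MvPolynomial (Fin r) k →ₐ[k] Module.End k (MvPolynomial (Fin r) k) :=
  AddMonoidAlgebra.lift k _ (Fin r →₀ ℕ)
    { toFun := fun D => monomialAction k r D.toAdd
      map_one' := monomialAction_zero k r
      map_mul' := fun D E => monomialAction_add k r D.toAdd E.toAdd }

variable {k r}

/-- The annihilator `Ann_R(W) = {F | F * f = 0 for all f ∈ W}` of a subspace `W` of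
`k[x_1, …, x_r]`. -/
def annihilator (W : Submodule k (MvPolynomial (Fin r) k)) :
    Ideal (MvPolynomial (Fin r) k) where
  carrier := {F | ∀ f ∈ W, diffAction k r F f = 0}
  add_mem' := by
    intro F G hF hG f hf
    rw [map_add, LinearMap.add_apply, hF f hf, hG f hf, add_zero]
  zero_mem' := by
    intro f _
    rw [map_zero, LinearMap.zero_apply]
  smul_mem' := by
    intro G F hF f hf
    rw [smul_eq_mul, map_mul, Module.End.mul_apply, hF f hf, map_zero]

end Action

/-! ### Constrained monomials -/

/-- The set `M_K(d)` of the multi-indexes `I = (I_1, …, I_r)` of degree `d` that are constrained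
by `K = (K_1, …, K_n)`, `n ≤ r`: those with `I_i ≤ K_i` for `i = 1, …, n`. -/
def constrained (r : ℕ) (K : List ℕ) (d : ℕ) : Finset (Fin r →₀ ℕ) :=
  {I ∈ Finset.univ.finsuppAntidiag d | ∀ i : Fin r, ∀ q ∈ K[(i : ℕ)]?, I i ≤ q}

/-- The coefficients of `s` forms of degree `j` in `r` variables all of whose monomials are
constrained by `K`. -/
abbrev CoeffIndex (r j : ℕ) (K : List ℕ) (s : ℕ) : Type := Fin s × ↥(constrained r K j)

/-- The span of the `s` forms `∑_J C_{mJ} x^J`, `m = 1, …, s`, where `J` runs through the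
multi-indexes of degree `j` constrained by `K`. -/
def formSpan {k : Type*} [Field k] {r j : ℕ} {K : List ℕ} {s : ℕ}
    (C : CoeffIndex r j K s → k) : Submodule k (MvPolynomial (Fin r) k) :=
  Submodule.span k (Set.range fun m : Fin s =>
    ∑ J : ↥(constrained r K j), MvPolynomial.monomial J.1 (C (m, J)))

/-- The coefficient matrix of `(j - d)`-th partial derivatives of `s` forms of degree `j`
constrained by `P`, cropped to the row indices `(E, m)` with `E ∈ M_P(j - d)`, `m ∈ {1, …, s}`
and to the column indices `D ∈ M_P(d)`, has at least as many rows as columns for `d = i_f`. -/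
def IsSufficient (r j : ℕ) (P : List ℕ) (i_f s : ℕ) : Prop :=
  Fintype.card ↥(constrained r P i_f) ≤ Fintype.card (↥(constrained r P (j - i_f)) × Fin s)

/-! ### The three families -/

/-- Coefficients `(C, C')` of `s` forms constrained by `P` and of one form constrained by `Q`. -/
abbrev PairIndex (r j : ℕ) (P Q : List ℕ) (s : ℕ) : Type :=
  CoeffIndex r j P s ⊕ CoeffIndex r j Q 1

/-- The ideal `Ann_R(E(C) + F(C'))`, where `E(C)` is spanned by `s` forms of degree `j`
constrained by `P` with coefficients `C`, and `F(C')` is spanned by one form of degree `j`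
constrained by `Q` with coefficients `C'`. -/
def pairIdeal {k : Type*} [Field k] {r j : ℕ} {P Q : List ℕ} {s : ℕ}
    (c : PairIndex r j P Q s → k) : Ideal (MvPolynomial (Fin r) k) :=
  annihilator (formSpan (fun x => c (Sum.inl x)) ⊔ formSpan (fun x => c (Sum.inr x)))

/-- The permitted parameters of the family `F_1(a, i, s)`. -/
structure F1Params (a i s : ℕ) : Prop where
  four_le : 4 ≤ a
  le_i : 2 * a ≤ i
  sufficient : IsSufficient 3 (i + a) [a - 1] (i + 3) s

/-- Coefficients `(C, C')` for `F_1(a, i, s)`: here `r = 3`, `j = i + a`, `P = (a - 1)`,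
`Q = (j, j, j)`. -/
abbrev F1Index (a i s : ℕ) : Type :=
  PairIndex 3 (i + a) [a - 1] [i + a, i + a, i + a] s

/-- The permitted parameters of the family `G_1(a, b, i, s)`. -/
structure G1Params (a b i s : ℕ) : Prop where
  two_le : 2 ≤ a
  a_le_b : a ≤ b
  le_i : a * b + 1 ≤ i
  sufficient : IsSufficient 4 (i + a * b) [a - 1, b - 1] (i + 3) s

/-- Coefficients `(C, C')` for `G_1(a, b, i, s)`: here `r = 4`, `j = i + ab`,
`P = (a - 1, b - 1)`, `Q = (j, j, j, 0)`. -/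
abbrev G1Index (a b i s : ℕ) : Type :=
  PairIndex 4 (i + a * b) [a - 1, b - 1] [i + a * b, i + a * b, i + a * b, 0] s

/-- The permitted parameters of the family `H_1(a, b, c, i, s)`. -/
structure H1Params (a b c i s : ℕ) : Prop where
  two_le : 2 ≤ a
  a_le_b : a ≤ b
  b_le_c : b ≤ c
  le_i : a * b * c ≤ i
  sufficient : IsSufficient 5 (i + a * b * c) [a - 1, b - 1, c - 1] (i + 3) s

/-- Coefficients `(C, C')` for `H_1(a, b, c, i, s)`: here `r = 5`, `j = i + abc`,
`P = (a - 1, b - 1, c - 1)`, `Q = (j, j, j, 0, 0)`. -/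
abbrev H1Index (a b c i s : ℕ) : Type :=
  PairIndex 5 (i + a * b * c) [a - 1, b - 1, c - 1]
    [i + a * b * c, i + a * b * c, i + a * b * c, 0, 0] s

/-! ### General elements of an affine space -/

section General

variable {k : Type*} [Field k] {σ : Type*}

/-- Zariski-open subsets of the affine space `k^σ`. -/
def IsZariskiOpen (U : Set (σ → k)) : Prop :=
  ∃ I : Ideal (MvPolynomial σ k), U = (MvPolynomial.zeroLocus k I)ᶜ

/-- Zariski-dense subsets of the affine space `k^σ`. -/
def IsZariskiDense (U : Set (σ → k)) : Prop :=
  ∀ V : Set (σ → k), IsZariskiOpen V → V.Nonempty → (U ∩ V).Nonempty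

/-- The statement `S` is true for general `c ∈ k^σ`: it is true on a dense Zariski-open subset. -/
def ForGeneral (S : (σ → k) → Prop) : Prop :=
  ∃ U : Set (σ → k), IsZariskiOpen U ∧ IsZariskiDense U ∧ ∀ c ∈ U, S c

end General

end

end LevelAlg

/-! By Macaulay duality (`hilbertFunction_annihilator`), the Hilbert function of R/Ann(W) in degree
d is the dimension of the space of (j-d)-th derivatives of W, and R/Ann(W) is level of type dim W
(`isLevel_annihilator`). Take W spanned by s forms constrained by P and one ternary form φ. Put N =
a, ab or abc, so that j = i + N. Suppose the derivatives of order N - 3 of the s forms fill all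
P-constrained forms of degree i + 3, and that the operators of order N act injectively on φ even
modulo P-constrained forms. Then for i ≤ d ≤ i + 3 the Hilbert function is m_P(d) + m_Q(j - d).

In this range m_P grows by exactly N per degree, the number of lattice points in the box of
constrained exponents, while m_Q(e) = (e+1)(e+2)/2 drops by N + 1, then N, then N - 1. The Hilbert
function therefore changes by -1, 0, +1, so it is not unimodal (`isNonUnimodalLevel_pair`).

Both suppositions, and the independence of the s forms, say that a matrix with entries polynomial in
the coefficients has a left inverse. Each holds on a principal open set, nonempty as soon as one
example exists (`exists_polynomial_left_inverse`, `forGeneral_isNonUnimodalLevel`). The examples are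
the heart of the proof. For φ, the divided coefficients 1/(m+1) along a line of exponents split the
linear system by weight into Cauchy systems (`hasInjectiveForm_ternary`). For spanning, two
monomials suffice in codimension 4 and 5 (`hasSpanningForms_box`). In codimension 3 four forms are
used, two with Cauchy coefficients, a monomial and a binomial (`hasSpanningForms_three`); hence the
bounds t ≥ 3 and t ≥ 5. The boxes are taken with equal sides a, large compared with s, and i = N +
a. -/

namespace LevelAlg

noncomputable section

section

open MvPolynomial

/-! ### Divided coefficients -/

section DividedCoefficients

variable {k : Type*} [Field k] {r : ℕ}

/-- The product `D! = ∏ i, (D i)!`. -/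
def multiFactorial (D : Fin r →₀ ℕ) : ℕ := ∏ i, (D i).factorial

theorem multiFactorial_ne_zero [CharZero k] (D : Fin r →₀ ℕ) : (multiFactorial D : k) ≠ 0 :=
  Nat.cast_ne_zero.mpr (Finset.prod_ne_zero_iff.mpr fun i _ => Nat.factorial_ne_zero (D i))

theorem multiFactorial_add_single (D : Fin r →₀ ℕ) (i : Fin r) :
    multiFactorial (D + Finsupp.single i 1) = (D i + 1) * multiFactorial D := by
  unfold multiFactorial
  rw [← Finset.mul_prod_erase _ _ (Finset.mem_univ i),
    ← Finset.mul_prod_erase Finset.univ (fun l => (D l).factorial) (Finset.mem_univ i), ← mul_assoc]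
  congr 1
  · simp [Nat.factorial_succ]
  · refine Finset.prod_congr rfl fun l hl => ?_
    simp [(Finset.ne_of_mem_erase hl).symm]

/-- The coefficient of `x^D / D!`. -/
def dcoeff (D : Fin r →₀ ℕ) : MvPolynomial (Fin r) k →ₗ[k] k :=
  (multiFactorial D : k) • lcoeff k D

theorem dcoeff_apply (D : Fin r →₀ ℕ) (f : MvPolynomial (Fin r) k) :
    dcoeff D f = multiFactorial D * coeff D f := rfl

theorem dcoeff_eq_zero_iff [CharZero k] {D : Fin r →₀ ℕ} {f : MvPolynomial (Fin r) k} :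
    dcoeff D f = 0 ↔ coeff D f = 0 := by
  rw [dcoeff_apply, mul_eq_zero, or_iff_right (multiFactorial_ne_zero D)]

theorem eq_zero_of_dcoeff [CharZero k] {f : MvPolynomial (Fin r) k} (h : ∀ D, dcoeff D f = 0) :
    f = 0 := by
  ext D
  exact dcoeff_eq_zero_iff.mp (h D)

theorem dcoeff_monomial (D E : Fin r →₀ ℕ) (c : k) :
    dcoeff D (monomial E c) = if E = D then multiFactorial D * c else 0 := by
  rw [dcoeff_apply, coeff_monomial]
  split_ifs <;> simp

theorem dcoeff_partialDeriv (D : Fin r →₀ ℕ) (i : Fin r) (f : MvPolynomial (Fin r) k) :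
    dcoeff D (partialDeriv k r i f) = dcoeff (D + Finsupp.single i 1) f := by
  have h : partialDeriv k r i f = pderiv i f := rfl
  rw [dcoeff_apply, dcoeff_apply, h, coeff_pderiv, multiFactorial_add_single]
  push_cast
  ring

theorem monomialAction_single (i : Fin r) :
    monomialAction k r (Finsupp.single i 1) = partialDeriv k r i := by
  have h := Finset.mul_noncommProd_erase Finset.univ (Finset.mem_univ i) _
    (partialDeriv_pow_pairwise k r (Finsupp.single i 1))
  have h' := Finset.noncommProd_eq_pow_card (Finset.univ.erase i) _
    (fun a ha b hb hab => partialDeriv_pow_pairwise k r (Finsupp.single i 1)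
      (Finset.mem_univ a) (Finset.mem_univ b) hab) 1
    fun l hl => by simp [(Finset.ne_of_mem_erase hl).symm]
  refine h.symm.trans ((congrArg _ h').trans ?_)
  simp

/-- With the factorials absorbed, differentiation is a pure shift of indices. This turns every rank
question below into one about Hankel-like matrices. -/
theorem dcoeff_monomialAction (D E : Fin r →₀ ℕ) (f : MvPolynomial (Fin r) k) :
    dcoeff D (monomialAction k r E f) = dcoeff (D + E) f := by
  induction E using Finsupp.induction_linear generalizing D f with
  | zero => simp [monomialAction_zero]
  | add E E' hE hE' =>
    rw [monomialAction_add, Module.End.mul_apply, hE, hE', add_assoc]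
  | single i n =>
    induction n generalizing D f with
    | zero => simp [monomialAction_zero]
    | succ n ih =>
      rw [Finsupp.single_add, monomialAction_add, Module.End.mul_apply, ih, monomialAction_single,
        dcoeff_partialDeriv, add_assoc]

theorem diffAction_monomial (E : Fin r →₀ ℕ) (c : k) :
    diffAction k r (monomial E c) = c • monomialAction k r E := by
  unfold diffAction
  rw [← single_eq_monomial]
  exact AddMonoidAlgebra.lift_single _ _ _

theorem diffAction_apply (G f : MvPolynomial (Fin r) k) :
    diffAction k r G f = ∑ E ∈ G.support, coeff E G • monomialAction k r E f := by
  conv_lhs => rw [G.as_sum, map_sum, LinearMap.sum_apply]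
  simp only [diffAction_monomial, LinearMap.smul_apply]

theorem dcoeff_diffAction (D : Fin r →₀ ℕ) (G f : MvPolynomial (Fin r) k) :
    dcoeff D (diffAction k r G f) = ∑ E ∈ G.support, coeff E G * dcoeff (D + E) f := by
  simp [diffAction_apply, map_sum, dcoeff_monomialAction]

theorem dcoeff_diffAction_of_subset (D : Fin r →₀ ℕ) (G f : MvPolynomial (Fin r) k)
    {S : Finset (Fin r →₀ ℕ)} (hS : G.support ⊆ S) :
    dcoeff D (diffAction k r G f) = ∑ E ∈ S, coeff E G * dcoeff (D + E) f := by
  rw [dcoeff_diffAction]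
  refine Finset.sum_subset hS fun E _ hE => ?_
  rw [notMem_support_iff.mp hE, zero_mul]

theorem isHomogeneous_iff_dcoeff [CharZero k] {f : MvPolynomial (Fin r) k} {d : ℕ} :
    f.IsHomogeneous d ↔ ∀ D : Fin r →₀ ℕ, D.degree ≠ d → dcoeff D f = 0 := by
  constructor
  · intro h D hD
    exact dcoeff_eq_zero_iff.mpr (h.coeff_eq_zero hD)
  · intro h D hD
    by_contra hne
    refine hD (dcoeff_eq_zero_iff.mp (h D ?_))
    rwa [Finsupp.degree_eq_weight_one]

theorem diffAction_isHomogeneous [CharZero k] {G f : MvPolynomial (Fin r) k} {j d e : ℕ}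
    (hf : f.IsHomogeneous j) (hG : G.IsHomogeneous e) (hde : d + e = j) :
    (diffAction k r G f).IsHomogeneous d := by
  rw [isHomogeneous_iff_dcoeff] at hf ⊢
  intro D hD
  rw [dcoeff_diffAction]
  refine Finset.sum_eq_zero fun E hE => ?_
  have hE' : E.degree = e := by
    by_contra hne
    exact (mem_support_iff.mp hE) (hG.coeff_eq_zero hne)
  rw [hf, mul_zero]
  rw [map_add]
  omega

theorem diffAction_eq_zero_of_degree_lt [CharZero k] {G f : MvPolynomial (Fin r) k} {j e : ℕ}
    (hf : f.IsHomogeneous j) (hG : G.IsHomogeneous e) (he : j < e) :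
    diffAction k r G f = 0 := by
  rw [isHomogeneous_iff_dcoeff] at hf
  refine eq_zero_of_dcoeff fun D => ?_
  rw [dcoeff_diffAction]
  refine Finset.sum_eq_zero fun E hE => ?_
  have hE' : E.degree = e := by
    by_contra hne
    exact (mem_support_iff.mp hE) (hG.coeff_eq_zero hne)
  rw [hf, mul_zero]
  rw [map_add]
  omega

end DividedCoefficients

/-! ### Constrained monomials and the polynomials that they span -/

section Constrained

variable {k : Type*} [Field k] {r : ℕ} {K : List ℕ} {d : ℕ}

theorem mem_constrained {D : Fin r →₀ ℕ} :
    D ∈ constrained r K d ↔ D.degree = d ∧ ∀ i : Fin r, ∀ q ∈ K[(i : ℕ)]?, D i ≤ q := by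
  rw [constrained, Finset.mem_filter, Finset.mem_finsuppAntidiag, Finsupp.degree_eq_sum]
  simp

theorem mem_constrained_of_le {D J : Fin r →₀ ℕ} {j : ℕ} (hJ : J ∈ constrained r K j)
    (hD : D.degree = d) (h : D ≤ J) : D ∈ constrained r K d :=
  mem_constrained.mpr ⟨hD, fun i q hq => (h i).trans ((mem_constrained.mp hJ).2 i q hq)⟩

variable (k) in
/-- The span of the monomials of degree `d` that are constrained by `K`. -/
def constrainedSpan (r : ℕ) (K : List ℕ) (d : ℕ) : Submodule k (MvPolynomial (Fin r) k) :=
  restrictSupport k (constrained r K d : Set (Fin r →₀ ℕ))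

instance : Module.Finite k (constrainedSpan k r K d) :=
  Module.Finite.of_basis (basisRestrictSupport k (constrained r K d : Set (Fin r →₀ ℕ)))

theorem finrank_constrainedSpan :
    Module.finrank k (constrainedSpan k r K d) = (constrained r K d).card := by
  unfold constrainedSpan
  rw [Module.finrank_eq_card_basis
    (basisRestrictSupport k (constrained r K d : Set (Fin r →₀ ℕ)))]
  simp

theorem mem_constrainedSpan_iff_support {f : MvPolynomial (Fin r) k} :
    f ∈ constrainedSpan k r K d ↔ f.support ⊆ constrained r K d := by
  unfold constrainedSpan
  rw [mem_restrictSupport_iff, Finset.coe_subset]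

theorem mem_constrainedSpan_iff {f : MvPolynomial (Fin r) k} :
    f ∈ constrainedSpan k r K d ↔ ∀ D ∉ constrained r K d, coeff D f = 0 := by
  rw [mem_constrainedSpan_iff_support]
  refine forall_congr' fun D => ?_
  rw [mem_support_iff]
  tauto

theorem mem_constrainedSpan_iff_dcoeff [CharZero k] {f : MvPolynomial (Fin r) k} :
    f ∈ constrainedSpan k r K d ↔ ∀ D ∉ constrained r K d, dcoeff D f = 0 := by
  simp only [mem_constrainedSpan_iff, dcoeff_eq_zero_iff]

theorem monomial_mem_constrainedSpan {D : Fin r →₀ ℕ} (hD : D ∈ constrained r K d) (c : k) :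
    monomial D c ∈ constrainedSpan k r K d :=
  (monomial_mem_restrictSupport k).mpr (Or.inl hD)

theorem constrainedSpan_le_iff {V : Submodule k (MvPolynomial (Fin r) k)} :
    constrainedSpan k r K d ≤ V ↔ ∀ D ∈ constrained r K d, monomial D 1 ∈ V := by
  unfold constrainedSpan
  rw [restrictSupport_eq_span, Submodule.span_le]
  exact Set.image_subset_iff

theorem isHomogeneous_of_mem_constrainedSpan {f : MvPolynomial (Fin r) k}
    (hf : f ∈ constrainedSpan k r K d) : f.IsHomogeneous d := by
  intro D hD
  refine (DFunLike.congr_fun Finsupp.degree_eq_weight_one D).symm.trans ?_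
  have := mem_constrainedSpan_iff_support.mp hf (mem_support_iff.mpr hD)
  exact (mem_constrained.mp this).1

theorem constrainedSpan_nil : constrainedSpan k r [] d = homogeneousSubmodule (Fin r) k d := by
  ext f
  constructor
  · exact isHomogeneous_of_mem_constrainedSpan
  · intro hf
    refine mem_constrainedSpan_iff.mpr fun D hD => ?_
    refine IsHomogeneous.coeff_eq_zero hf fun h => hD (mem_constrained.mpr ⟨h, ?_⟩)
    simp

instance finite_homogeneousSubmodule : Module.Finite k (homogeneousSubmodule (Fin r) k d) := by
  rw [← constrainedSpan_nil]
  infer_instance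

theorem monomialAction_mem_constrainedSpan [CharZero k] {f : MvPolynomial (Fin r) k} {j : ℕ}
    (hf : f ∈ constrainedSpan k r K j) (E : Fin r →₀ ℕ) (hE : d + E.degree = j) :
    monomialAction k r E f ∈ constrainedSpan k r K d := by
  rw [mem_constrainedSpan_iff_dcoeff] at hf ⊢
  intro D hD
  rw [dcoeff_monomialAction]
  refine hf _ fun h => hD (mem_constrained_of_le h ?_ le_self_add)
  have := (mem_constrained.mp h).1
  rw [map_add] at this
  omega

theorem formSpan_le_constrainedSpan {j s : ℕ} (C : CoeffIndex r j K s → k) :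
    formSpan C ≤ constrainedSpan k r K j := by
  refine Submodule.span_le.mpr ?_
  rintro _ ⟨m, rfl⟩
  exact Submodule.sum_mem _ fun J _ => monomial_mem_constrainedSpan J.2 _

end Constrained

/-! ### Derivatives of spaces of forms and Hilbert functions -/

section Derivatives

variable {k : Type*} [Field k] {r : ℕ}

/-- The span of the `e`-th partial derivatives of the elements of `W`. -/
def derivatives (W : Submodule k (MvPolynomial (Fin r) k)) (e : ℕ) :
    Submodule k (MvPolynomial (Fin r) k) :=
  ⨆ E : {E : Fin r →₀ ℕ // E.degree = e}, W.map (monomialAction k r E.1)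

variable {W W' : Submodule k (MvPolynomial (Fin r) k)} {e e' d j : ℕ}

theorem monomialAction_mem_derivatives {f : MvPolynomial (Fin r) k} (hf : f ∈ W)
    {E : Fin r →₀ ℕ} (hE : E.degree = e) : monomialAction k r E f ∈ derivatives W e :=
  Submodule.mem_iSup_of_mem (⟨E, hE⟩ : {E : Fin r →₀ ℕ // E.degree = e})
    (Submodule.mem_map_of_mem hf)

theorem derivatives_le_iff {V : Submodule k (MvPolynomial (Fin r) k)} :
    derivatives W e ≤ V ↔
      ∀ E : Fin r →₀ ℕ, E.degree = e → ∀ f ∈ W, monomialAction k r E f ∈ V := by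
  simp only [derivatives, iSup_le_iff, Subtype.forall, Submodule.map_le_iff_le_comap]
  rfl

theorem diffAction_mem_derivatives {f G : MvPolynomial (Fin r) k} (hf : f ∈ W)
    (hG : G.IsHomogeneous e) : diffAction k r G f ∈ derivatives W e := by
  rw [diffAction_apply]
  refine Submodule.sum_mem _ fun E hE => Submodule.smul_mem _ _ ?_
  refine monomialAction_mem_derivatives hf ?_
  by_contra hne
  exact (mem_support_iff.mp hE) (hG.coeff_eq_zero hne)

theorem derivatives_sup : derivatives (W ⊔ W') e = derivatives W e ⊔ derivatives W' e := by
  simp only [derivatives, Submodule.map_sup, iSup_sup_eq]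

theorem derivatives_mono (h : W ≤ W') : derivatives W e ≤ derivatives W' e :=
  iSup_mono fun _ => Submodule.map_mono h

theorem derivatives_zero : derivatives W 0 = W := by
  apply le_antisymm
  · refine derivatives_le_iff.mpr fun E hE f hf => ?_
    rw [(Finsupp.degree_eq_zero_iff E).mp hE, monomialAction_zero]
    exact hf
  · intro f hf
    have := monomialAction_mem_derivatives hf (map_zero (Finsupp.degree : (Fin r →₀ ℕ) →+ ℕ))
    rwa [monomialAction_zero] at this

theorem derivatives_derivatives_le :
    derivatives (derivatives W e) e' ≤ derivatives W (e + e') := by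
  refine derivatives_le_iff.mpr fun E hE f hf => ?_
  suffices h : derivatives W e ≤ (derivatives W (e + e')).comap (monomialAction k r E) from h hf
  refine derivatives_le_iff.mpr fun E' hE' g hg => ?_
  rw [Submodule.mem_comap, ← Module.End.mul_apply, ← monomialAction_add]
  refine monomialAction_mem_derivatives hg ?_
  rw [map_add, hE, hE', add_comm]

theorem derivatives_le_constrainedSpan [CharZero k] {K : List ℕ}
    (hW : W ≤ constrainedSpan k r K j) (hde : d + e = j) :
    derivatives W e ≤ constrainedSpan k r K d :=
  derivatives_le_iff.mpr fun E hE _ hf =>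
    monomialAction_mem_constrainedSpan (hW hf) E (by rw [hE, hde])

theorem derivatives_le_homogeneousSubmodule [CharZero k]
    (hW : W ≤ homogeneousSubmodule (Fin r) k j) (hde : d + e = j) :
    derivatives W e ≤ homogeneousSubmodule (Fin r) k d := by
  rw [← constrainedSpan_nil] at hW ⊢
  exact derivatives_le_constrainedSpan hW hde

/-! ### The pairing of forms -/

/-- The pairing `(G, h) ↦ G * h` of the forms of degree `d` with themselves. -/
def pairing (k : Type*) [Field k] (r d : ℕ) :
    LinearMap.BilinForm k (homogeneousSubmodule (Fin r) k d) :=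
  LinearMap.mk₂ k (fun G h => dcoeff 0 (diffAction k r G.1 h.1))
    (fun _ _ _ => by simp) (fun _ _ _ => by simp) (fun _ _ _ => by simp) (fun _ _ _ => by simp)

theorem pairing_apply (G h : homogeneousSubmodule (Fin r) k d) :
    pairing k r d G h =
      ∑ E ∈ constrained r [] d, multiFactorial E * (coeff E G.1 * coeff E h.1) := by
  have hG : G.1.support ⊆ constrained r [] d := by
    rw [← mem_constrainedSpan_iff_support, constrainedSpan_nil]
    exact G.2
  refine (dcoeff_diffAction_of_subset 0 G.1 h.1 hG).trans ?_
  refine Finset.sum_congr rfl fun E _ => ?_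
  rw [zero_add, dcoeff_apply]
  ring

theorem pairing_comm (G h : homogeneousSubmodule (Fin r) k d) :
    pairing k r d G h = pairing k r d h G := by
  simp only [pairing_apply]
  exact Finset.sum_congr rfl fun E _ => by rw [mul_comm (coeff E G.1)]

/-- Monomials are orthogonal with self-pairing `D!`, which is nonzero in characteristic 0. -/
theorem pairing_separating [CharZero k] (G : homogeneousSubmodule (Fin r) k d)
    (hG : ∀ h, pairing k r d G h = 0) : G = 0 := by
  apply Subtype.ext
  ext D
  rw [ZeroMemClass.coe_zero, coeff_zero]
  by_cases hD : D.degree = d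
  · have hmem : D ∈ constrained r [] d := mem_constrained.mpr ⟨hD, by simp⟩
    have h := hG ⟨monomial D 1, isHomogeneous_monomial 1 hD⟩
    rw [pairing_apply, Finset.sum_eq_single_of_mem D hmem] at h
    · simpa [multiFactorial_ne_zero, multiFactorial, Finset.prod_eq_zero_iff,
        Nat.factorial_ne_zero] using h
    · intro E _ hED
      simp [coeff_monomial, hED.symm]
  · exact IsHomogeneous.coeff_eq_zero G.2 hD

theorem pairing_nondegenerate [CharZero k] : (pairing k r d).Nondegenerate :=
  ⟨pairing_separating, fun G hG => pairing_separating G fun h => by rw [pairing_comm, hG h]⟩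

theorem dcoeff_diffAction_eq (D : Fin r →₀ ℕ) (G f : MvPolynomial (Fin r) k) :
    dcoeff D (diffAction k r G f) = dcoeff 0 (diffAction k r G (monomialAction k r D f)) := by
  simp only [dcoeff_diffAction, dcoeff_monomialAction, zero_add, add_comm D]

theorem mem_annihilator {G : MvPolynomial (Fin r) k} :
    G ∈ annihilator W ↔ ∀ f ∈ W, diffAction k r G f = 0 := Iff.rfl

/-- The result of applying G to f has degree e, and its divided coefficient at D is the pairing of G
with the D-th derivative of f. -/
theorem mem_annihilator_iff_pairing [CharZero k] (hW : W ≤ homogeneousSubmodule (Fin r) k j)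
    (hde : d + e = j) (G : homogeneousSubmodule (Fin r) k d) :
    G.1 ∈ annihilator W ↔
      ∀ h : homogeneousSubmodule (Fin r) k d, h.1 ∈ derivatives W e → pairing k r d G h = 0 := by
  constructor
  · intro hG h hh
    suffices H : derivatives W e ≤
        LinearMap.ker ((dcoeff 0).comp (diffAction k r G.1)) from H hh
    refine derivatives_le_iff.mpr fun E _ f hf => ?_
    rw [LinearMap.mem_ker, LinearMap.comp_apply, ← dcoeff_diffAction_eq,
      mem_annihilator.mp hG f hf, map_zero]
  · intro H
    rw [mem_annihilator]
    intro f hf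
    refine eq_zero_of_dcoeff fun D => ?_
    by_cases hD : D.degree = e
    · rw [dcoeff_diffAction_eq]
      have hmem := monomialAction_mem_derivatives hf hD
      exact H ⟨_, derivatives_le_homogeneousSubmodule hW hde hmem⟩ hmem
    · exact isHomogeneous_iff_dcoeff.mp
        (diffAction_isHomogeneous (hW hf) G.2 ((add_comm e d).trans hde)) D hD

/-- Macaulay duality: the degree d part of the annihilator is the orthogonal complement of the
derivatives, so its codimension is their dimension. -/
theorem hilbertFunction_annihilator [CharZero k] (hW : W ≤ homogeneousSubmodule (Fin r) k j)
    (hde : d + e = j) :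
    hilbertFunction (annihilator W) d = Module.finrank k (derivatives W e) := by
  set V := (derivatives W e).comap (homogeneousSubmodule (Fin r) k d).subtype
  have hV : Module.finrank k V = Module.finrank k (derivatives W e) :=
    (Submodule.comapSubtypeEquivOfLe
      (derivatives_le_homogeneousSubmodule hW hde)).finrank_eq
  set φ := (Ideal.Quotient.mkₐ k (annihilator W)).toLinearMap.domRestrict
    (homogeneousSubmodule (Fin r) k d)
  have hrange : hilbertFunction (annihilator W) d = Module.finrank k (LinearMap.range φ) := by
    rw [LinearMap.range_domRestrict]
    rfl
  have hker : LinearMap.ker φ = (pairing k r d).orthogonal V := by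
    ext G
    rw [LinearMap.mem_ker, LinearMap.BilinForm.mem_orthogonal_iff]
    refine (Ideal.Quotient.eq_zero_iff_mem (I := annihilator W)).trans ?_
    refine (mem_annihilator_iff_pairing hW hde G).trans ?_
    refine forall₂_congr fun h _ => ?_
    rw [pairing_comm]
  have h1 := LinearMap.finrank_range_add_finrank_ker φ
  have h2 := LinearMap.BilinForm.finrank_orthogonal (pairing_nondegenerate (k := k) (r := r)
    (d := d)) V
  have h3 := Submodule.finrank_le V
  rw [hker] at h1
  omega

theorem mk_mem_gradedPiece {I : Ideal (MvPolynomial (Fin r) k)} {G : MvPolynomial (Fin r) k}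
    (hG : G.IsHomogeneous d) : Ideal.Quotient.mk I G ∈ gradedPiece I d :=
  ⟨G, hG, rfl⟩

end Derivatives

/-! ### Level quotients -/

section Level

variable {k : Type*} [Field k] [CharZero k] {r j : ℕ}
  {W : Submodule k (MvPolynomial (Fin r) k)}

theorem homogeneousComponent_diffAction {f : MvPolynomial (Fin r) k} (hf : f.IsHomogeneous j)
    (G : MvPolynomial (Fin r) k) (D : Fin r →₀ ℕ) {d : ℕ} (hD : D.degree + d = j) :
    dcoeff D (diffAction k r (homogeneousComponent d G) f) = dcoeff D (diffAction k r G f) := by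
  have hsub : (homogeneousComponent d G).support ⊆ G.support := by
    intro E hE
    rw [mem_support_iff, coeff_homogeneousComponent] at hE
    rw [mem_support_iff]
    intro h
    simp [h] at hE
  rw [dcoeff_diffAction_of_subset D _ f hsub, dcoeff_diffAction]
  refine Finset.sum_congr rfl fun E _ => ?_
  rw [coeff_homogeneousComponent]
  split_ifs with h
  · rfl
  · rw [isHomogeneous_iff_dcoeff.mp hf, mul_zero, mul_zero]
    rw [map_add]
    omega

theorem homogeneousComponent_mem_annihilator (hW : W ≤ homogeneousSubmodule (Fin r) k j)
    {G : MvPolynomial (Fin r) k} (hG : G ∈ annihilator W) (d : ℕ) :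
    homogeneousComponent d G ∈ annihilator W := by
  rw [mem_annihilator] at hG ⊢
  intro f hf
  rcases lt_or_ge j d with hd | hd
  · exact diffAction_eq_zero_of_degree_lt (hW hf) (homogeneousComponent_isHomogeneous d G) hd
  refine eq_zero_of_dcoeff fun D => ?_
  by_cases hD : D.degree + d = j
  · rw [homogeneousComponent_diffAction (hW hf) G D hD, hG f hf, map_zero]
  · refine isHomogeneous_iff_dcoeff.mp (diffAction_isHomogeneous (d := j - d) (hW hf)
      (homogeneousComponent_isHomogeneous d G) (by omega)) D (by omega)

theorem mem_annihilator_of_degree_gt (hW : W ≤ homogeneousSubmodule (Fin r) k j)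
    {G : MvPolynomial (Fin r) k} {d : ℕ} (hG : G.IsHomogeneous d) (hd : j < d) :
    G ∈ annihilator W :=
  mem_annihilator.mpr fun _ hf => diffAction_eq_zero_of_degree_lt (hW hf) hG hd

theorem gradedPiece_eq_bot_of_gt (hW : W ≤ homogeneousSubmodule (Fin r) k j) {d : ℕ}
    (hd : j < d) : gradedPiece (annihilator W) d = ⊥ := by
  refine (Submodule.eq_bot_iff _).mpr ?_
  rintro _ ⟨G, hG, rfl⟩
  exact Ideal.Quotient.eq_zero_iff_mem.mpr (mem_annihilator_of_degree_gt hW hG hd)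

theorem finite_quotient_annihilator (hW : W ≤ homogeneousSubmodule (Fin r) k j) :
    Module.Finite k (MvPolynomial (Fin r) k ⧸ annihilator W) := by
  have htop : (⨆ d ∈ Finset.range (j + 1), gradedPiece (annihilator W) d) = ⊤ := by
    refine eq_top_iff.mpr fun x _ => ?_
    obtain ⟨G, rfl⟩ := Ideal.Quotient.mk_surjective x
    rw [← sum_homogeneousComponent G, map_sum]
    refine Submodule.sum_mem _ fun d _ => ?_
    have hmem := mk_mem_gradedPiece (I := annihilator W) (homogeneousComponent_isHomogeneous d G)
    by_cases hd : d ∈ Finset.range (j + 1)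
    · exact Submodule.mem_iSup_of_mem d (Submodule.mem_iSup_of_mem hd hmem)
    · rw [gradedPiece_eq_bot_of_gt hW (by simpa using hd), Submodule.mem_bot] at hmem
      rw [hmem]
      exact zero_mem _
  refine ⟨?_⟩
  rw [← htop]
  refine Submodule.fg_biSup _ _ fun d _ => ?_
  exact Submodule.FG.map _ (Module.Finite.iff_fg.mp finite_homogeneousSubmodule)

/-- If every `X l * G` kills f, then all first derivatives of the result of G on f vanish. That
result is a constant, and only the degree j component of G contributes to it. -/
theorem socle_annihilator (hW : W ≤ homogeneousSubmodule (Fin r) k j) :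
    socle (annihilator W) = gradedPiece (annihilator W) j := by
  apply le_antisymm
  · intro x hx
    obtain ⟨G, rfl⟩ := Ideal.Quotient.mk_surjective x
    have hX : ∀ l, X l * G ∈ annihilator W := by
      intro l
      rw [← Ideal.Quotient.eq_zero_iff_mem, map_mul, mul_comm]
      exact hx _ (mk_mem_gradedPiece (isHomogeneous_X k l))
    suffices h : G - homogeneousComponent j G ∈ annihilator W by
      rw [Ideal.Quotient.eq.mpr h]
      exact mk_mem_gradedPiece (homogeneousComponent_isHomogeneous j G)
    rw [mem_annihilator]
    intro f hf
    refine eq_zero_of_dcoeff fun D => ?_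
    rw [map_sub, LinearMap.sub_apply, map_sub, sub_eq_zero]
    by_cases hD : D = 0
    · rw [homogeneousComponent_diffAction (hW hf) G D (by simp [hD])]
    · obtain ⟨l, hl⟩ := Finsupp.ne_iff.mp hD
      have hle : Finsupp.single l 1 ≤ D := by
        rw [Finsupp.single_le_iff]
        exact Nat.one_le_iff_ne_zero.mpr hl
      have h1 : dcoeff D (diffAction k r G f) = 0 := by
        rw [← tsub_add_cancel_of_le hle, ← dcoeff_partialDeriv]
        have h2 := mem_annihilator.mp (hX l) f hf
        rw [map_mul, Module.End.mul_apply, X, diffAction_monomial, one_smul,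
          monomialAction_single] at h2
        rw [h2, map_zero]
      rw [h1, isHomogeneous_iff_dcoeff.mp (diffAction_isHomogeneous (d := 0) (hW hf)
        (homogeneousComponent_isHomogeneous j G) (zero_add j)) D]
      rwa [Ne, Finsupp.degree_eq_zero_iff]
  · rintro _ ⟨G, hG, rfl⟩ _ ⟨L, hL, rfl⟩
    refine (map_mul (Ideal.Quotient.mk (annihilator W)) G L).symm.trans ?_
    exact Ideal.Quotient.eq_zero_iff_mem.mpr
      (mem_annihilator_of_degree_gt hW (IsHomogeneous.mul hG hL) (Nat.lt_succ_self j))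

theorem isLevel_annihilator (hW : W ≤ homogeneousSubmodule (Fin r) k j) (hne : W ≠ ⊥) :
    IsLevel (annihilator W) j where
  homogeneous _ hF d := homogeneousComponent_mem_annihilator hW hF d
  artinian := finite_quotient_annihilator hW
  top_ne_bot h := by
    have hfin : Module.Finite k W := Submodule.finiteDimensional_of_le hW
    have h0 := hilbertFunction_annihilator hW (add_zero j)
    rw [derivatives_zero, hilbertFunction, h, finrank_bot] at h0
    exact hne (Submodule.finrank_eq_zero.mp h0.symm)
  eq_bot_of_gt _ hd := gradedPiece_eq_bot_of_gt hW hd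
  socle_eq := socle_annihilator hW

end Level

/-- A peak at or before `i + 1` forbids the later rise; a peak after it forbids the earlier drop. -/
theorem not_unimodal_of_lt {h : ℕ → ℕ} {i j : ℕ} (hij : i + 3 ≤ j) (h1 : h (i + 1) < h i)
    (h2 : h (i + 1) < h (i + 3)) : ¬ Unimodal h j := by
  rintro ⟨l, -, hmono, hanti⟩
  rcases le_or_gt l (i + 1) with hl | hl
  · have := hanti (a := i + 1) (b := i + 3) ⟨hl, by omega⟩ ⟨by omega, hij⟩ (by omega)
    omega
  · have := hmono (a := i) (b := i + 1) ⟨by omega, by omega⟩ ⟨by omega, by omega⟩ (by omega)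
    omega

/-! ### General elements -/

section General

variable {k : Type*} [Field k] {σ : Type*}

/-- A nonempty principal open set is dense: over an infinite field the product of two nonzero
polynomials is nonzero at some point. -/
theorem forGeneral_of_polynomial [Infinite k] {S : (σ → k) → Prop} (Φ : MvPolynomial σ k)
    (hΦ : Φ ≠ 0) (h : ∀ c, eval c Φ ≠ 0 → S c) : ForGeneral S := by
  have hmem : ∀ c : σ → k, c ∈ (zeroLocus k (Ideal.span {Φ}))ᶜ ↔ eval c Φ ≠ 0 := by
    intro c
    rw [Set.mem_compl_iff, mem_zeroLocus_iff, not_iff_not]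
    constructor
    · intro h
      exact h Φ (Ideal.mem_span_singleton_self Φ)
    · intro h p hp
      obtain ⟨q, rfl⟩ := Ideal.mem_span_singleton'.mp hp
      rw [map_mul]
      exact mul_eq_zero_of_right _ h
  refine ⟨_, ⟨Ideal.span {Φ}, rfl⟩, ?_, fun c hc => h c ((hmem c).mp hc)⟩
  rintro V ⟨I, rfl⟩ ⟨c, hc⟩
  rw [Set.mem_compl_iff, mem_zeroLocus_iff] at hc
  push Not at hc
  obtain ⟨p, hpI, hp⟩ := hc
  have hp0 : p ≠ 0 := by
    rintro rfl
    simp at hp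
  obtain ⟨x, hx⟩ : ∃ x, eval x (Φ * p) ≠ 0 := by
    by_contra! hall
    refine mul_ne_zero hΦ hp0 (funext fun x => ?_)
    rw [hall x, map_zero]
  rw [map_mul] at hx
  refine ⟨x, (hmem x).mpr (left_ne_zero_of_mul hx), ?_⟩
  rw [Set.mem_compl_iff, mem_zeroLocus_iff]
  intro hall
  exact right_ne_zero_of_mul hx (hall p hpI)

theorem exists_of_forGeneral {S : (σ → k) → Prop} (h : ForGeneral S) : ∃ c, S c := by
  obtain ⟨U, -, hU, hS⟩ := h
  have hopen : IsZariskiOpen (Set.univ : Set (σ → k)) := by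
    refine ⟨⊤, ?_⟩
    rw [eq_comm, Set.compl_univ_iff, Set.eq_empty_iff_forall_notMem]
    intro x hx
    simpa using mem_zeroLocus_iff.mp hx 1 trivial
  obtain ⟨c, hc, -⟩ := hU Set.univ hopen ⟨0, trivial⟩
  exact ⟨c, hS c hc⟩

variable {m n : Type*} [Fintype m] [Fintype n] [DecidableEq n]

theorem exists_left_inverse {A : Matrix m n k}
    (hA : ∀ x : n → k, A.mulVec x = 0 → x = 0) : ∃ L : Matrix n m k, L * A = 1 := by
  classical
  obtain ⟨g, hg⟩ := LinearMap.exists_leftInverse_of_injective (Matrix.toLin' A)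
    (LinearMap.ker_eq_bot'.mpr fun x hx => hA x (by rwa [Matrix.toLin'_apply] at hx))
  refine ⟨LinearMap.toMatrix' g, ?_⟩
  rw [← LinearMap.toMatrix'_toLin' A, ← LinearMap.toMatrix'_comp, hg, LinearMap.toMatrix'_id]

/-- A matrix of polynomials that has a left inverse at one point has one at every point where some
nonzero polynomial does not vanish. -/
theorem exists_polynomial_left_inverse (A : Matrix m n (MvPolynomial σ k))
    {M : (σ → k) → Matrix m n k} (hA : ∀ c, A.map (eval c) = M c) (c₀ : σ → k)
    (h : ∀ x : n → k, (M c₀).mulVec x = 0 → x = 0) :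
    ∃ Φ : MvPolynomial σ k, Φ ≠ 0 ∧
      ∀ c, eval c Φ ≠ 0 → ∃ L : Matrix n m k, L * M c = 1 := by
  -- The scalar matrix `L` stays fixed while the point varies, so `det (L * A)` is a polynomial; its
  -- value at `c₀` is 1.
  obtain ⟨L, hL⟩ := exists_left_inverse h
  obtain ⟨L', hL'⟩ : ∃ L' : Matrix n m (MvPolynomial σ k), L' = L.map C := ⟨_, rfl⟩
  obtain ⟨B, hB⟩ : ∃ B : Matrix n n (MvPolynomial σ k), B = L' * A := ⟨_, rfl⟩
  have heval : ∀ c, eval c B.det = Matrix.det (L * M c : Matrix n n k) := by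
    intro c
    rw [← hA, RingHom.map_det, RingHom.mapMatrix_apply, hB, Matrix.map_mul, hL', Matrix.map_map]
    congr 2
    ext a b
    simp
  refine ⟨B.det, ?_, ?_⟩
  · intro h0
    have := heval c₀
    rw [h0, hL, map_zero, Matrix.det_one] at this
    exact zero_ne_one this
  · intro c hc
    rw [heval] at hc
    refine ⟨(L * M c)⁻¹ * L, ?_⟩
    rw [Matrix.mul_assoc]
    exact Matrix.nonsing_inv_mul _ (isUnit_iff_ne_zero.mpr hc)

end General

/-! ### Forms with given coefficients -/

section Forms

variable {k : Type*} [Field k] {r j s : ℕ} {K : List ℕ}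

/-- The `m`-th of the forms with coefficients `C`. -/
def form (C : CoeffIndex r j K s → k) (m : Fin s) : MvPolynomial (Fin r) k :=
  ∑ J : ↥(constrained r K j), monomial J.1 (C (m, J))

theorem formSpan_eq_span_form (C : CoeffIndex r j K s → k) :
    formSpan C = Submodule.span k (Set.range (form C)) := rfl

theorem form_mem_formSpan (C : CoeffIndex r j K s → k) (m : Fin s) : form C m ∈ formSpan C :=
  Submodule.subset_span ⟨m, rfl⟩

theorem form_mem_constrainedSpan (C : CoeffIndex r j K s → k) (m : Fin s) :
    form C m ∈ constrainedSpan k r K j :=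
  formSpan_le_constrainedSpan C (form_mem_formSpan C m)

theorem dcoeff_form (C : CoeffIndex r j K s → k) (m : Fin s) (D : Fin r →₀ ℕ) :
    dcoeff D (form C m) =
      if h : D ∈ constrained r K j then multiFactorial D * C (m, ⟨D, h⟩) else 0 := by
  simp only [form, map_sum, dcoeff_monomial]
  split_ifs with h
  · rw [Finset.sum_eq_single_of_mem (⟨D, h⟩ : ↥(constrained r K j)) (Finset.mem_univ _)]
    · simp
    · intro J _ hJ
      rw [if_neg]
      rintro rfl
      exact hJ rfl
  · refine Finset.sum_eq_zero fun J _ => ?_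
    rw [if_neg]
    rintro rfl
    exact h J.2

/-- The divided coefficient at `D` of the `m`-th form, as a polynomial in the coefficients. -/
def dcoeffPoly (k : Type*) [Field k] {σ : Type*} (ι : CoeffIndex r j K s → σ) (m : Fin s)
    (D : Fin r →₀ ℕ) : MvPolynomial σ k :=
  if h : D ∈ constrained r K j then C (multiFactorial D : k) * X (ι (m, ⟨D, h⟩)) else 0

theorem eval_dcoeffPoly {σ : Type*} (ι : CoeffIndex r j K s → σ) (m : Fin s)
    (D : Fin r →₀ ℕ) (c : σ → k) :
    eval c (dcoeffPoly k ι m D) = dcoeff D (form (fun x => c (ι x)) m) := by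
  rw [dcoeff_form, dcoeffPoly]
  split_ifs <;> simp

theorem dcoeff_form_div [CharZero k] (g : Fin s → (Fin r →₀ ℕ) → k)
    (hg : ∀ m, ∀ J ∉ constrained r K j, g m J = 0) (m : Fin s) (D : Fin r →₀ ℕ) :
    dcoeff D (form (fun x : CoeffIndex r j K s => g x.1 x.2.1 / multiFactorial x.2.1) m) =
      g m D := by
  rw [dcoeff_form]
  split_ifs with h
  · exact mul_div_cancel₀ _ (multiFactorial_ne_zero D)
  · exact (hg m D h).symm

theorem monomialAction_monomial_add [CharZero k] (D E : Fin r →₀ ℕ) :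
    monomialAction k r E (monomial (D + E) (multiFactorial D / multiFactorial (D + E) : k)) =
      monomial D 1 := by
  refine sub_eq_zero.mp (eq_zero_of_dcoeff fun D' => ?_)
  rw [map_sub, dcoeff_monomialAction, dcoeff_monomial, dcoeff_monomial, sub_eq_zero]
  by_cases h : D = D'
  · subst h
    rw [if_pos rfl, if_pos rfl, mul_one, mul_div_cancel₀ _ (multiFactorial_ne_zero _)]
  · rw [if_neg h, if_neg fun h' => h (add_right_cancel h')]

/-- The matrix of the `e`-th partial derivatives of the forms with coefficients `C`. -/
def derivativeMatrix (C : CoeffIndex r j K s → k) (d e : ℕ) :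
    Matrix (↥(constrained r K e) × Fin s) ↥(constrained r K d) k :=
  fun x D => dcoeff (D.1 + x.1.1) (form C x.2)

/-- Row D of the left inverse gives the combination of derivatives equal to `x^D / D!`. -/
theorem constrainedSpan_le_derivatives [CharZero k] (C : CoeffIndex r j K s → k) {d e : ℕ}
    (hde : d + e = j)
    (h : ∃ L : Matrix ↥(constrained r K d) (↥(constrained r K e) × Fin s) k,
      L * derivativeMatrix C d e = 1) :
    constrainedSpan k r K d ≤ derivatives (formSpan C) e := by
  obtain ⟨L, hL⟩ := h
  refine constrainedSpan_le_iff.mpr fun D hD => ?_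
  have hmem : ∑ x, L ⟨D, hD⟩ x • monomialAction k r x.1.1 (form C x.2) ∈
      derivatives (formSpan C) e :=
    Submodule.sum_mem _ fun x _ => Submodule.smul_mem _ _
      (monomialAction_mem_derivatives (form_mem_formSpan C x.2) (mem_constrained.mp x.1.2).1)
  suffices heq : monomial D (1 : k) = (multiFactorial D : k) •
      ∑ x, L ⟨D, hD⟩ x • monomialAction k r x.1.1 (form C x.2) by
    rw [heq]
    exact Submodule.smul_mem _ _ hmem
  refine sub_eq_zero.mp (eq_zero_of_dcoeff fun D' => ?_)
  rw [map_sub, sub_eq_zero, map_smul, dcoeff_monomial]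
  by_cases hD' : D' ∈ constrained r K d
  · have h1 := congrFun (congrFun hL ⟨D, hD⟩) ⟨D', hD'⟩
    rw [Matrix.mul_apply, Matrix.one_apply] at h1
    simp only [map_sum, map_smul, dcoeff_monomialAction, smul_eq_mul]
    refine Eq.trans ?_ (congrArg (fun y => (multiFactorial D : k) * y) h1.symm)
    simp only [Subtype.mk.injEq, mul_ite, mul_one, mul_zero]
    split_ifs with h
    · rw [h]
    · rfl
  · rw [if_neg (by rintro rfl; exact hD' hD), mem_constrainedSpan_iff_dcoeff.mp
      (derivatives_le_constrainedSpan (formSpan_le_constrainedSpan C) hde hmem) D' hD', smul_zero]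

/-- A monomial of lower degree is, up to a scalar, a derivative in the free variable z of its
product with a power of z. Spanning thus passes down to all lower degrees. -/
theorem constrainedSpan_le_derivatives_of_le [CharZero k]
    {W : Submodule k (MvPolynomial (Fin r) k)} {z : Fin r} (hz : K[(z : ℕ)]? = none) {d e : ℕ}
    (h : constrainedSpan k r K d ≤ derivatives W e) {d' e' : ℕ} (hd : d' + e' = d + e)
    (hle : d' ≤ d) : constrainedSpan k r K d' ≤ derivatives W e' := by
  refine constrainedSpan_le_iff.mpr fun D hD => ?_
  obtain ⟨n, rfl⟩ := Nat.exists_eq_add_of_le hle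
  have hmem : D + Finsupp.single z n ∈ constrained r K (d' + n) := by
    rw [mem_constrained] at hD ⊢
    refine ⟨by rw [map_add, hD.1, Finsupp.degree_single], fun l q hq => ?_⟩
    by_cases hl : l = z
    · subst hl
      simp [hz] at hq
    · simpa [Finsupp.single_apply, Ne.symm hl] using hD.2 l q hq
  rw [← monomialAction_monomial_add D (Finsupp.single z n)]
  obtain rfl : e' = e + n := by omega
  exact derivatives_derivatives_le (monomialAction_mem_derivatives
    (h (monomial_mem_constrainedSpan hmem _)) (Finsupp.degree_single z n))

/-- The operators of degree `e` constrained by `Q` act injectively on `φ` modulo the forms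
constrained by `P`. -/
def ActsInjectively (P Q : List ℕ) (d e : ℕ) (φ : MvPolynomial (Fin r) k) : Prop :=
  ∀ G ∈ constrainedSpan k r Q e, diffAction k r G φ ∈ constrainedSpan k r P d → G = 0

/-- The matrix of the action of the operators of degree `e` constrained by `Q` on `φ` modulo the
forms constrained by `P`. -/
def actionMatrix (P Q : List ℕ) (d e : ℕ) (φ : MvPolynomial (Fin r) k) :
    Matrix ↥(constrained r [] d \ constrained r P d) ↥(constrained r Q e) k :=
  fun D E => dcoeff (D.1 + E.1) φ

theorem actsInjectively_of_left_inverse [CharZero k] {P Q : List ℕ} {d e : ℕ}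
    {φ : MvPolynomial (Fin r) k} (h : ∃ L : Matrix ↥(constrained r Q e) ↥(constrained r [] d \ constrained r P d) k,
      L * actionMatrix P Q d e φ = 1) :
    ActsInjectively P Q d e φ := by
  obtain ⟨L, hL⟩ := h
  intro G hG hφ
  have hzero : (actionMatrix P Q d e φ).mulVec (fun E => coeff E.1 G) = 0 := by
    ext D
    have h1 := mem_constrainedSpan_iff_dcoeff.mp hφ D.1 (Finset.mem_sdiff.mp D.2).2
    rw [dcoeff_diffAction_of_subset D.1 G φ (mem_constrainedSpan_iff_support.mp hG),
      ← Finset.sum_coe_sort] at h1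
    rw [Pi.zero_apply, ← h1]
    exact Finset.sum_congr rfl fun E _ => mul_comm _ _
  have h2 : (fun E : ↥(constrained r Q e) => coeff E.1 G) = 0 := by
    rw [← Matrix.one_mulVec (fun E : ↥(constrained r Q e) => coeff E.1 G), ← hL,
      ← Matrix.mulVec_mulVec, hzero, Matrix.mulVec_zero]
  ext E
  by_cases hE : E ∈ constrained r Q e
  · exact congrFun h2 ⟨E, hE⟩
  · exact mem_constrainedSpan_iff.mp hG E hE

/-- Multiplying G by a power of the variable x raises its order to e, and differentiating further
keeps the result P-constrained. -/
theorem ActsInjectively.of_le [CharZero k] {P Q : List ℕ} {d e d' e' : ℕ}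
    {φ : MvPolynomial (Fin r) k} (h : ActsInjectively P Q d e φ) {x : Fin r}
    (hx : ∀ q ∈ Q[(x : ℕ)]?, e ≤ q) (hde : d' + e' = d + e) (hle : e' ≤ e) :
    ActsInjectively P Q d' e' φ := by
  intro G hG hφ
  obtain ⟨n, rfl⟩ := Nat.exists_eq_add_of_le hle
  set E : Fin r →₀ ℕ := Finsupp.single x n
  have hmem : monomial E 1 * G ∈ constrainedSpan k r Q (e' + n) := by
    refine mem_constrainedSpan_iff.mpr fun D hD => ?_
    rw [coeff_monomial_mul']
    split_ifs with hle
    · rw [one_mul]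
      refine mem_constrainedSpan_iff.mp hG _ fun hDE => hD ?_
      rw [mem_constrained] at hDE ⊢
      have hdeg : D.degree = e' + n := by
        rw [← tsub_add_cancel_of_le hle, map_add, hDE.1, Finsupp.degree_single]
      refine ⟨hdeg, fun l q hq => ?_⟩
      by_cases hl : l = x
      · subst hl
        exact ((Finsupp.le_degree l D).trans hdeg.le).trans (hx q hq)
      · have := hDE.2 l q hq
        simpa [E, Finsupp.single_apply, Ne.symm hl] using this
    · rfl
  have h0 := h _ hmem (by
    rw [map_mul, Module.End.mul_apply, diffAction_monomial, one_smul]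
    refine monomialAction_mem_constrainedSpan hφ E ?_
    rw [Finsupp.degree_single]
    omega)
  exact (mul_eq_zero.mp h0).resolve_left (by simp)

/-- Operators whose exponents violate Q kill φ, so only the Q-constrained ones matter. -/
theorem derivatives_span_singleton [CharZero k] {Q : List ℕ} {φ : MvPolynomial (Fin r) k}
    (hφ : φ ∈ constrainedSpan k r Q j) (e : ℕ) :
    derivatives (Submodule.span k {φ}) e =
      (constrainedSpan k r Q e).map ((diffAction k r).toLinearMap.flip φ) := by
  apply le_antisymm
  · refine derivatives_le_iff.mpr fun E hE f hf => ?_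
    obtain ⟨t, rfl⟩ := Submodule.mem_span_singleton.mp hf
    by_cases hEQ : E ∈ constrained r Q e
    · refine ⟨monomial E t, monomial_mem_constrainedSpan hEQ t, ?_⟩
      simp [diffAction_monomial]
    · suffices h0 : monomialAction k r E (t • φ) = 0 by
        rw [h0]
        exact zero_mem _
      refine eq_zero_of_dcoeff fun D => ?_
      rw [map_smul, map_smul, dcoeff_monomialAction,
        mem_constrainedSpan_iff_dcoeff.mp hφ _ fun h =>
          hEQ (mem_constrained_of_le h hE le_add_self), smul_zero]
  · refine Submodule.map_le_iff_le_comap.mpr fun G hG => ?_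
    have h := diffAction_mem_derivatives (Submodule.mem_span_singleton_self φ)
      (isHomogeneous_of_mem_constrainedSpan hG)
    exact h

theorem ActsInjectively.finrank_derivatives [CharZero k] {P Q : List ℕ} {d e : ℕ}
    {φ : MvPolynomial (Fin r) k} (h : ActsInjectively P Q d e φ)
    (hφ : φ ∈ constrainedSpan k r Q j) :
    Module.finrank k (derivatives (Submodule.span k {φ}) e) = (constrained r Q e).card := by
  rw [derivatives_span_singleton hφ, ← finrank_constrainedSpan (k := k)]
  rw [← LinearMap.range_domRestrict]
  refine LinearMap.finrank_range_of_inj (LinearMap.ker_eq_bot.mp (LinearMap.ker_eq_bot'.mpr ?_))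
  intro G hG
  refine Subtype.ext (h G.1 G.2 ?_)
  have hG' : diffAction k r G.1 φ = 0 := hG
  rw [hG']
  exact zero_mem _

theorem ActsInjectively.disjoint [CharZero k] {P Q : List ℕ} {d e : ℕ}
    {φ : MvPolynomial (Fin r) k} (h : ActsInjectively P Q d e φ)
    (hφ : φ ∈ constrainedSpan k r Q j) :
    Disjoint (constrainedSpan k r P d) (derivatives (Submodule.span k {φ}) e) := by
  rw [derivatives_span_singleton hφ, Submodule.disjoint_def]
  rintro _ hP ⟨G, hG, rfl⟩
  rw [h G hG hP, map_zero]

theorem sum_mul_extend {S : Finset (Fin r →₀ ℕ)} (u : (Fin r →₀ ℕ) → k) (y : ↥S → k) :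
    ∑ D ∈ S, u D * (if h : D ∈ S then y ⟨D, h⟩ else 0) = ∑ D : ↥S, u D.1 * y D := by
  rw [← Finset.sum_coe_sort]
  exact Finset.sum_congr rfl fun D _ => by rw [dif_pos D.2]

theorem formSpan_one (C : CoeffIndex r j K 1 → k) :
    formSpan C = Submodule.span k {form C 0} := by
  rw [formSpan_eq_span_form, Set.range_unique]
  rfl

/-- The matrix of the coefficients of the forms. -/
def coeffMatrix (C : CoeffIndex r j K s → k) : Matrix ↥(constrained r K j) (Fin s) k :=
  fun J m => dcoeff J.1 (form C m)

theorem finrank_formSpan_of_left_inverse {C : CoeffIndex r j K s → k}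
    (h : ∃ L : Matrix (Fin s) ↥(constrained r K j) k, L * coeffMatrix C = 1) :
    Module.finrank k (formSpan C) = s := by
  obtain ⟨L, hL⟩ := h
  rw [formSpan_eq_span_form]
  refine (finrank_span_eq_card ?_).trans (Fintype.card_fin s)
  rw [Fintype.linearIndependent_iff]
  intro y hy
  have hzero : (coeffMatrix C).mulVec y = 0 := by
    ext J
    have h1 := congrArg (dcoeff J.1) hy
    rw [map_sum, map_zero] at h1
    rw [Pi.zero_apply, ← h1, Matrix.mulVec, dotProduct]
    refine Finset.sum_congr rfl fun m _ => ?_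
    rw [map_smul, smul_eq_mul, mul_comm]
    rfl
  have h2 : y = 0 := by
    rw [← Matrix.one_mulVec y, ← hL, ← Matrix.mulVec_mulVec, hzero, Matrix.mulVec_zero]
  exact congrFun h2

theorem map_eval_derivativeMatrix {σ : Type*} (ι : CoeffIndex r j K s → σ) (d e : ℕ)
    (c : σ → k) :
    (Matrix.of fun (x : ↥(constrained r K e) × Fin s) (D : ↥(constrained r K d)) =>
      dcoeffPoly k ι x.2 (D.1 + x.1.1)).map (eval c) =
        derivativeMatrix (fun x => c (ι x)) d e := by
  ext x D
  rw [Matrix.map_apply, Matrix.of_apply, eval_dcoeffPoly]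
  rfl

theorem map_eval_actionMatrix {σ : Type*} {P Q : List ℕ} (ι : CoeffIndex r j K 1 → σ) (d e : ℕ)
    (c : σ → k) :
    (Matrix.of fun (D : ↥(constrained r [] d \ constrained r P d)) (E : ↥(constrained r Q e)) =>
      dcoeffPoly k ι 0 (D.1 + E.1)).map (eval c) =
        actionMatrix P Q d e (form (fun x => c (ι x)) 0) := by
  ext D E
  rw [Matrix.map_apply, Matrix.of_apply, eval_dcoeffPoly]
  rfl

theorem map_eval_coeffMatrix {σ : Type*} (ι : CoeffIndex r j K s → σ) (c : σ → k) :
    (Matrix.of fun (J : ↥(constrained r K j)) (m : Fin s) => dcoeffPoly k ι m J.1).map (eval c) =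
      coeffMatrix (fun x => c (ι x)) := by
  ext J m
  rw [Matrix.map_apply, Matrix.of_apply, eval_dcoeffPoly]
  rfl

end Forms

/-! ### The combined algebra: its Hilbert function and the general choice of coefficients -/

section Pair

variable {k : Type*} [Field k] [CharZero k] {r i N s : ℕ} {P Q : List ℕ}

/-- Injectivity modulo P-constrained forms makes the two spaces of derivatives meet only in 0, so
dimensions add. -/
theorem hilbertFunction_pair {j : ℕ} {W : Submodule k (MvPolynomial (Fin r) k)}
    {φ : MvPolynomial (Fin r) k} (hW : W ≤ constrainedSpan k r P j)
    (hφ : φ ∈ constrainedSpan k r Q j) {d e : ℕ} (hde : d + e = j)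
    (hinj : ActsInjectively P Q d e φ) :
    hilbertFunction (annihilator (W ⊔ Submodule.span k {φ})) d =
      Module.finrank k (derivatives W e) + (constrained r Q e).card := by
  have hhom : W ⊔ Submodule.span k {φ} ≤ homogeneousSubmodule (Fin r) k j :=
    sup_le (fun f hf => isHomogeneous_of_mem_constrainedSpan (hW hf))
      ((Submodule.span_singleton_le_iff_mem _ _).mpr (isHomogeneous_of_mem_constrainedSpan hφ))
  have hle := derivatives_le_constrainedSpan hW hde
  have hfin : Module.Finite k (derivatives W e) := Submodule.finiteDimensional_of_le hle
  have hfin' : Module.Finite k (derivatives (Submodule.span k {φ}) e) := by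
    rw [derivatives_span_singleton hφ]
    infer_instance
  have hdisj : derivatives W e ⊓ derivatives (Submodule.span k {φ}) e = ⊥ :=
    disjoint_iff.mp ((hinj.disjoint hφ).mono_left hle)
  have h := Submodule.finrank_sup_add_finrank_inf_eq (derivatives W e)
    (derivatives (Submodule.span k {φ}) e)
  rw [hdisj, finrank_bot, add_zero, hinj.finrank_derivatives hφ] at h
  rw [hilbertFunction_annihilator hhom hde, derivatives_sup, h]

theorem constrained_eq_nil_of_le_one (hP : ∀ q ∈ P, 1 ≤ q) {d : ℕ} (hd : d ≤ 1) :
    constrained r P d = constrained r [] d := by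
  ext D
  rw [mem_constrained, mem_constrained]
  refine and_congr_right fun hD => ⟨fun _ => by simp, fun _ l q hq => ?_⟩
  calc D l ≤ D.degree := Finsupp.le_degree l D
    _ ≤ 1 := hD.trans_le hd
    _ ≤ q := hP q (List.mem_of_getElem? hq)

/-- Since the bounds in P are at least 1, every form of degree at most 1 is constrained. The
derivatives then fill these degrees, and only 0 is orthogonal to everything. -/
theorem hasCodimEqNumVars_of_constrainedSpan_le {j : ℕ}
    {W : Submodule k (MvPolynomial (Fin r) k)} (hW : W ≤ homogeneousSubmodule (Fin r) k j)
    (hj : 1 ≤ j) (hP : ∀ q ∈ P, 1 ≤ q)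
    (h : ∀ d ≤ 1, constrainedSpan k r P d ≤ derivatives W (j - d)) :
    HasCodimEqNumVars (annihilator W) := by
  intro d hd F hF hdeg
  have hle := h d hd
  unfold constrainedSpan at hle
  rw [constrained_eq_nil_of_le_one hP hd] at hle
  change constrainedSpan k r [] d ≤ _ at hle
  rw [constrainedSpan_nil] at hle
  have h1 := (mem_annihilator_iff_pairing hW (by omega : d + (j - d) = j)
    (⟨F, hdeg⟩ : homogeneousSubmodule (Fin r) k d)).mp hF
  exact congrArg Subtype.val (pairing_separating _ fun h' => h1 h' (hle h'.2))

theorem isNonUnimodalLevel_pair {W : Submodule k (MvPolynomial (Fin r) k)}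
    {φ : MvPolynomial (Fin r) k} {z x : Fin r} (hN : 3 ≤ N) (hz : P[(z : ℕ)]? = none)
    (hx : ∀ q ∈ Q[(x : ℕ)]?, N ≤ q) (hP : ∀ q ∈ P, 1 ≤ q)
    (hcard : (constrained r P (i + 1)).card ≤ (constrained r P i).card + N)
    (hcard' : (constrained r P (i + 1)).card + 2 * N ≤ (constrained r P (i + 3)).card)
    (hQ : (constrained r Q (N - 1)).card + N + 1 ≤ (constrained r Q N).card)
    (hQ' : (constrained r Q (N - 1)).card < 2 * N + (constrained r Q (N - 3)).card)
    (hW : W ≤ constrainedSpan k r P (i + N)) (hφ : φ ∈ constrainedSpan k r Q (i + N))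
    (hdim : Module.finrank k W = s)
    (hle : constrainedSpan k r P (i + 3) ≤ derivatives W (N - 3))
    (hinj : ActsInjectively P Q i N φ) :
    IsNonUnimodalLevel r (annihilator (W ⊔ Submodule.span k {φ})) (s + 1) := by
  have hle' : ∀ d e, d + e = i + N → d ≤ i + 3 → constrainedSpan k r P d ≤ derivatives W e :=
    fun d e hde hd => constrainedSpan_le_derivatives_of_le hz hle (by omega) hd
  have hhilb : ∀ d e, d + e = i + N → e ≤ N → d ≤ i + 3 →
      hilbertFunction (annihilator (W ⊔ Submodule.span k {φ})) d =
        (constrained r P d).card + (constrained r Q e).card := by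
    intro d e hde he hd
    rw [hilbertFunction_pair hW hφ hde (hinj.of_le hx hde he),
      le_antisymm (derivatives_le_constrainedSpan hW hde) (hle' d e hde hd),
      finrank_constrainedSpan]
  have htype : hilbertFunction (annihilator (W ⊔ Submodule.span k {φ})) (i + N) = s + 1 := by
    rw [hilbertFunction_pair hW hφ (add_zero _)
      (hinj.of_le hx (add_zero _) (Nat.zero_le N)), derivatives_zero, hdim]
    congr 1
    rw [Finset.card_eq_one]
    refine ⟨0, Finset.eq_singleton_iff_unique_mem.mpr ⟨?_, fun D hD => ?_⟩⟩
    · exact mem_constrained.mpr ⟨map_zero _, by simp⟩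
    · exact (Finsupp.degree_eq_zero_iff D).mp (mem_constrained.mp hD).1
  have hhom : W ⊔ Submodule.span k {φ} ≤ homogeneousSubmodule (Fin r) k (i + N) :=
    sup_le (fun f hf => isHomogeneous_of_mem_constrainedSpan (hW hf))
      ((Submodule.span_singleton_le_iff_mem _ _).mpr (isHomogeneous_of_mem_constrainedSpan hφ))
  refine ⟨hasCodimEqNumVars_of_constrainedSpan_le hhom (by omega) hP fun d hd =>
    (hle' d (i + N - d) (by omega) (by omega)).trans (derivatives_mono le_sup_left),
    i + N, isLevel_annihilator hhom ?_, htype, not_unimodal_of_lt (i := i) (by omega) ?_ ?_⟩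
  · intro h
    have h0 := hilbertFunction_annihilator hhom (add_zero _)
    rw [htype, derivatives_zero, h, finrank_bot] at h0
    omega
  -- The P-part gains at most N, the Q-part loses at least N + 1.
  · rw [hhilb i N rfl le_rfl (by omega), hhilb (i + 1) (N - 1) (by omega) (by omega) (by omega)]
    omega
  -- Over these two degrees the P-part gains at least 2N, the Q-part loses less than 2N.
  · rw [hhilb (i + 1) (N - 1) (by omega) (by omega) (by omega),
      hhilb (i + 3) (N - 3) (by omega) (by omega) (by omega)]
    omega

/-- The partial derivatives of order `e` of some `s` forms of degree `d + e` that are constrained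
by `P` span all forms of degree `d` that are constrained by `P`, in terms of the divided
coefficients of the forms. -/
def HasSpanningForms (k : Type*) [Field k] (r : ℕ) (P : List ℕ) (d e s : ℕ) : Prop :=
  ∃ g : Fin s → (Fin r →₀ ℕ) → k, (∀ m, ∀ J ∉ constrained r P (d + e), g m J = 0) ∧
    ∀ x : (Fin r →₀ ℕ) → k, (∀ D ∉ constrained r P d, x D = 0) →
      (∀ m, ∀ E ∈ constrained r P e, ∑ D ∈ constrained r P d, g m (D + E) * x D = 0) →
      ∀ D ∈ constrained r P d, x D = 0

/-- Some form of degree `d + e` constrained by `Q` is acted on injectively by the operators of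
degree `e` that are constrained by `Q`, modulo the forms constrained by `P`, in terms of the
divided coefficients of the form. -/
def HasInjectiveForm (k : Type*) [Field k] (r : ℕ) (P Q : List ℕ) (d e : ℕ) : Prop :=
  ∃ g : (Fin r →₀ ℕ) → k, (∀ J ∉ constrained r Q (d + e), g J = 0) ∧
    ∀ x : (Fin r →₀ ℕ) → k, (∀ E ∉ constrained r Q e, x E = 0) →
      (∀ D ∈ constrained r [] d, D ∉ constrained r P d →
        ∑ E ∈ constrained r Q e, g (D + E) * x E = 0) →
      ∀ E ∈ constrained r Q e, x E = 0

theorem HasSpanningForms.exists_derivativeMatrix {d e j : ℕ} (h : HasSpanningForms k r P d e s)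
    (hde : d + e = j) : ∃ C : CoeffIndex r j P s → k, ∀ x : ↥(constrained r P d) → k,
      (derivativeMatrix C d e).mulVec x = 0 → x = 0 := by
  subst hde
  obtain ⟨g, hg, hker⟩ := h
  refine ⟨fun x => g x.1 x.2.1 / multiFactorial x.2.1, fun y hy => ?_⟩
  have h0 := hker (fun D => if h : D ∈ constrained r P d then y ⟨D, h⟩ else 0)
    (fun D hD => dif_neg hD) (fun m E hE => ?_)
  · ext D
    have := h0 D.1 D.2
    rwa [dif_pos D.2] at this
  · rw [sum_mul_extend]
    have h1 := congrFun hy (⟨E, hE⟩, m)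
    refine Eq.trans (Finset.sum_congr rfl fun D _ => ?_) h1
    rw [← dcoeff_form_div g hg m]
    rfl

theorem HasInjectiveForm.exists_actionMatrix {d e : ℕ} (h : HasInjectiveForm k r P Q d e) :
    ∃ C : CoeffIndex r (d + e) Q 1 → k, ∀ x : ↥(constrained r Q e) → k,
      (actionMatrix P Q d e (form C 0)).mulVec x = 0 → x = 0 := by
  obtain ⟨g, hg, hker⟩ := h
  refine ⟨fun x => g x.2.1 / multiFactorial x.2.1, fun y hy => ?_⟩
  have h0 := hker (fun E => if h : E ∈ constrained r Q e then y ⟨E, h⟩ else 0)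
    (fun D hD => dif_neg hD) (fun D hD hD' => ?_)
  · ext E
    have := h0 E.1 E.2
    rwa [dif_pos E.2] at this
  · rw [sum_mul_extend]
    have h1 := congrFun hy ⟨D, Finset.mem_sdiff.mpr ⟨hD, hD'⟩⟩
    refine Eq.trans (Finset.sum_congr rfl fun E _ => ?_) h1
    rw [← dcoeff_form_div (s := 1) (fun _ => g) (fun _ => hg) 0]
    rfl

/-- An injective matrix has at least as many rows as columns, so the sufficiency inequality on s
follows from the existence of an example. -/
theorem HasSpanningForms.card_le {d e : ℕ} (h : HasSpanningForms k r P d e s) :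
    Fintype.card ↥(constrained r P d) ≤ Fintype.card (↥(constrained r P e) × Fin s) := by
  obtain ⟨C, hC⟩ := h.exists_derivativeMatrix rfl
  have h1 := LinearMap.finrank_le_finrank_of_injective
    (f := Matrix.toLin' (derivativeMatrix C d e))
    (LinearMap.ker_eq_bot.mp (LinearMap.ker_eq_bot'.mpr fun x hx =>
      hC x (by rwa [Matrix.toLin'_apply] at hx)))
  rwa [Module.finrank_fintype_fun_eq_card, Module.finrank_fintype_fun_eq_card] at h1

/-- The example consists of s distinct monomials. -/
theorem exists_coeffMatrix {j : ℕ} (hs : s ≤ (constrained r P j).card) :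
    ∃ C : CoeffIndex r j P s → k, ∀ x : Fin s → k, (coeffMatrix C).mulVec x = 0 → x = 0 := by
  obtain ⟨ι⟩ : Nonempty (Fin s ↪ ↥(constrained r P j)) :=
    Function.Embedding.nonempty_of_card_le (by simpa using hs)
  refine ⟨fun x => if ι x.1 = x.2 then 1 else 0, fun y hy => ?_⟩
  ext m
  have h1 := congrFun hy (ι m)
  rw [Matrix.mulVec, dotProduct, Finset.sum_eq_single_of_mem m (Finset.mem_univ m)] at h1
  · rw [coeffMatrix, dcoeff_form, dif_pos (ι m).2, if_pos rfl, mul_one] at h1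
    exact (mul_eq_zero.mp h1).resolve_left (multiFactorial_ne_zero _)
  · intro m' _ hm'
    rw [coeffMatrix, dcoeff_form, dif_pos (ι m).2, if_neg fun h => hm' (ι.injective h), mul_zero,
      zero_mul]

theorem forGeneral_isNonUnimodalLevel {z x : Fin r} (hN : 3 ≤ N) (hz : P[(z : ℕ)]? = none)
    (hx : ∀ q ∈ Q[(x : ℕ)]?, N ≤ q) (hP : ∀ q ∈ P, 1 ≤ q)
    (hcard : (constrained r P (i + 1)).card ≤ (constrained r P i).card + N)
    (hcard' : (constrained r P (i + 1)).card + 2 * N ≤ (constrained r P (i + 3)).card)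
    (hQ : (constrained r Q (N - 1)).card + N + 1 ≤ (constrained r Q N).card)
    (hQ' : (constrained r Q (N - 1)).card < 2 * N + (constrained r Q (N - 3)).card)
    (hs : s ≤ (constrained r P (i + N)).card)
    (hspan : HasSpanningForms k r P (i + 3) (N - 3) s) (hinj : HasInjectiveForm k r P Q i N) :
    IsSufficient r (i + N) P (i + 3) s ∧
      ForGeneral fun c : PairIndex r (i + N) P Q s → k =>
        IsNonUnimodalLevel r (pairIdeal c) (s + 1) := by
  have hj : i + 3 + (N - 3) = i + N := by omega
  constructor
  · have h := hspan.card_le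
    unfold IsSufficient
    rwa [show i + N - (i + 3) = N - 3 by omega]
  obtain ⟨C₁, hC₁⟩ := hspan.exists_derivativeMatrix hj
  obtain ⟨C₂, hC₂⟩ := hinj.exists_actionMatrix
  obtain ⟨C₃, hC₃⟩ := exists_coeffMatrix hs (k := k)
  -- Each rank condition involves one block of coefficients only, so its witness is extended by 0 on
  -- the other block. The three witnesses need not agree.
  obtain ⟨Φ₁, hΦ₁, H₁⟩ := exists_polynomial_left_inverse _
    (map_eval_derivativeMatrix (Sum.inl : _ → PairIndex r (i + N) P Q s) (i + 3) (N - 3))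
    (Sum.elim C₁ 0) hC₁
  obtain ⟨Φ₂, hΦ₂, H₂⟩ := exists_polynomial_left_inverse _
    (map_eval_actionMatrix (P := P) (Q := Q) (Sum.inr : _ → PairIndex r (i + N) P Q s) i N)
    (Sum.elim 0 C₂) hC₂
  obtain ⟨Φ₃, hΦ₃, H₃⟩ := exists_polynomial_left_inverse _
    (map_eval_coeffMatrix (Sum.inl : _ → PairIndex r (i + N) P Q s)) (Sum.elim C₃ 0) hC₃
  refine forGeneral_of_polynomial (Φ₁ * Φ₂ * Φ₃) (mul_ne_zero (mul_ne_zero hΦ₁ hΦ₂) hΦ₃)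
    fun c hc => ?_
  rw [map_mul, map_mul] at hc
  have H₁' := H₁ c (left_ne_zero_of_mul (left_ne_zero_of_mul hc))
  have H₂' := H₂ c (right_ne_zero_of_mul (left_ne_zero_of_mul hc))
  have H₃' := H₃ c (right_ne_zero_of_mul hc)
  rw [pairIdeal, formSpan_one]
  exact isNonUnimodalLevel_pair hN hz hx hP hcard hcard' hQ hQ' (formSpan_le_constrainedSpan _)
    (form_mem_constrainedSpan _ _) (finrank_formSpan_of_left_inverse H₃')
    (constrainedSpan_le_derivatives _ hj H₁') (actsInjectively_of_left_inverse H₂')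

end Pair

end

/-! ### Hankel systems -/

section Hankel

variable {k : Type*} [Field k] [CharZero k]

/-- Invertibility of Cauchy matrices by partial fractions. Clearing denominators in `∑ u l / (X + l
+ c + 1)` gives a polynomial of degree below K that vanishes at 0, …, K - 1, hence is 0. -/
theorem eq_zero_of_cauchy_system (K c : ℕ) (u : ℕ → k)
    (h : ∀ e < K, ∑ l ∈ Finset.range K, ((l + c + e : ℕ) + 1 : k)⁻¹ * u l = 0) :
    ∀ l < K, u l = 0 := by
  classical
  have hne : ∀ m : ℕ, (m + 1 : k) ≠ 0 := fun m => Nat.cast_add_one_ne_zero m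
  set t : ℕ → Polynomial k := fun l => Polynomial.X + Polynomial.C ((l + c : ℕ) + 1 : k)
  set p : Polynomial k := ∑ l ∈ Finset.range K,
    Polynomial.C (u l) * ∏ l' ∈ (Finset.range K).erase l, t l'
  have hp : p = 0 := by
    refine Polynomial.eq_zero_of_degree_lt_of_eval_finset_eq_zero
      ((Finset.range K).image (Nat.cast : ℕ → k)) ?_ ?_
    · rw [Finset.card_image_of_injective _ Nat.cast_injective, Finset.card_range]
      refine Polynomial.mem_degreeLT.mp (Submodule.sum_mem _ fun l hl => ?_)
      rw [← Polynomial.smul_eq_C_mul]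
      refine Submodule.smul_mem _ _ (Polynomial.mem_degreeLT.mpr ?_)
      rw [Polynomial.degree_prod]
      simp only [t, Polynomial.degree_X_add_C, Finset.sum_const, Finset.card_erase_of_mem hl,
        Finset.card_range, nsmul_eq_mul, mul_one]
      have := Finset.mem_range.mp hl
      exact_mod_cast (by omega : K - 1 < K)
    · intro x hx
      obtain ⟨e, he, rfl⟩ := Finset.mem_image.mp hx
      have heval : ∀ l, (t l).eval (e : k) = ((l + c + e : ℕ) + 1 : k) := by
        intro l
        simp only [t, Polynomial.eval_add, Polynomial.eval_X, Polynomial.eval_C]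
        push_cast
        ring
      have h1 := congrArg (fun y => y * ∏ l ∈ Finset.range K, ((l + c + e : ℕ) + 1 : k))
        (h e (Finset.mem_range.mp he))
      simp only [zero_mul, Finset.sum_mul] at h1
      rw [← h1, Polynomial.eval_finsetSum]
      refine Finset.sum_congr rfl fun l hl => ?_
      rw [Polynomial.eval_mul, Polynomial.eval_C, Polynomial.eval_prod,
        ← Finset.mul_prod_erase _ _ hl]
      simp only [heval]
      rw [mul_comm _ (u l), mul_assoc, inv_mul_cancel_left₀ (hne (l + c + e))]
  intro l hl
  -- At this pole only the l-th summand survives, as `u l` times a nonzero product.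
  have h1 := congrArg (Polynomial.eval (-((l + c : ℕ) + 1 : k))) hp
  rw [Polynomial.eval_zero, Polynomial.eval_finsetSum,
    Finset.sum_eq_single_of_mem l (Finset.mem_range.mpr hl)] at h1
  · rw [Polynomial.eval_mul, Polynomial.eval_C, mul_eq_zero] at h1
    refine h1.resolve_right ?_
    rw [Polynomial.eval_prod, ← Ne, Finset.prod_ne_zero_iff]
    intro l' hl'
    have hll : (l' : k) ≠ l := Nat.cast_injective.ne (Finset.ne_of_mem_erase hl')
    simp only [t, Polynomial.eval_add, Polynomial.eval_X, Polynomial.eval_C]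
    intro h0
    apply hll
    push_cast at h0
    linear_combination h0
  · intro l' _ hl'
    rw [Polynomial.eval_mul, Polynomial.eval_prod, mul_eq_zero]
    right
    refine Finset.prod_eq_zero (Finset.mem_erase.mpr ⟨hl'.symm, Finset.mem_range.mpr hl⟩) ?_
    simp only [t, Polynomial.eval_add, Polynomial.eval_X, Polynomial.eval_C]
    ring

/-- With `m = l + γ + e`, the unknowns l ≥ 0 and the rows e both run over 2l + γ ≤ n, 2e + γ ≤ n,
giving a square Cauchy system. `hneg` and `hlarge` remove all other terms. -/
theorem eq_zero_of_hankel_system (n γ : ℕ) (u : ℤ → k) (hneg : ∀ l < 0, u l = 0)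
    (hlarge : ∀ l : ℤ, n < 2 * l + γ → l + γ ≤ n → u l = 0)
    (hrow : ∀ e : ℕ, 2 * e + γ ≤ n →
      ∑ m ∈ Finset.range (n + 1), (m + 1 : k)⁻¹ * u (m - γ - e) = 0)
    (l : ℤ) (hl : 2 * l + γ ≤ n) : u l = 0 := by
  rcases lt_or_ge l 0 with h0 | h0
  · exact hneg l h0
  lift l to ℕ using h0
  refine eq_zero_of_cauchy_system ((n - γ) / 2 + 1) γ (fun l => u l) (fun e he => ?_) l (by omega)
  rw [← hrow e (by omega)]
  refine Eq.trans ?_ (Finset.sum_subset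
    (s₁ := (Finset.range ((n - γ) / 2 + 1)).image fun l => l + γ + e) ?_ ?_)
  · rw [Finset.sum_image fun _ _ _ _ h => by simpa using h]
    refine Finset.sum_congr rfl fun l _ => ?_
    rw [show ((l + γ + e : ℕ) : ℤ) - γ - e = l by push_cast; ring]
  · intro m hm
    obtain ⟨l, hl, rfl⟩ := Finset.mem_image.mp hm
    rw [Finset.mem_range] at hl ⊢
    omega
  · intro m hm hm'
    rw [Finset.mem_range] at hm
    refine mul_eq_zero_of_right _ ?_
    rcases lt_or_ge (m - γ - e : ℤ) 0 with h0 | h0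
    · exact hneg _ h0
    · refine hlarge _ ?_ (by omega)
      by_contra hcon
      refine hm' (Finset.mem_image.mpr ⟨m - γ - e, Finset.mem_range.mpr (by omega), by omega⟩)

/-- In each equation the difference of the first two indices is the constant `e₂ - e₁`. The system
splits by the weight v - p into Hankel systems, cut off where the third index turns negative. -/
theorem eq_zero_of_triangle_system (n : ℕ) (y : ℤ → ℤ → ℤ → k)
    (hout : ∀ v p q, v < 0 ∨ p < 0 ∨ q < 0 → y v p q = 0)
    (h : ∀ e₁ e₂ e₃ : ℤ, 0 ≤ e₁ → 0 ≤ e₂ → 0 ≤ e₃ → e₁ + e₂ + e₃ = n →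
      ∑ m ∈ Finset.range (n + 1),
        (m + 1 : k)⁻¹ * y (m - e₁) (m - e₂) (2 * n - 2 * m - e₃) = 0)
    (v p q : ℤ) (hsum : v + p + q = n) : y v p q = 0 := by
  by_cases hq : q < 0
  · exact hout _ _ _ (Or.inr (Or.inr hq))
  rcases le_total v p with hvp | hvp
  · obtain ⟨γ, hγ⟩ := Int.eq_ofNat_of_zero_le (sub_nonneg.mpr hvp)
    have key := eq_zero_of_hankel_system n γ (fun l => y l (l + γ) (n - 2 * l - γ))
      (fun l hl => hout _ _ _ (Or.inl hl))
      (fun l hl hl' => hout _ _ _ (Or.inr (Or.inr (by omega)))) (fun e he => ?_) v (by omega)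
    · simpa only [show (n : ℤ) - 2 * v - γ = q by omega, show v + γ = p by omega] using key
    · rw [← h (e + γ) e (n - 2 * e - γ) (by omega) (by omega) (by omega) (by omega)]
      refine Finset.sum_congr rfl fun m _ => ?_
      congr 2 <;> ring
  · obtain ⟨γ, hγ⟩ := Int.eq_ofNat_of_zero_le (sub_nonneg.mpr hvp)
    have key := eq_zero_of_hankel_system n γ (fun l => y (l + γ) l (n - 2 * l - γ))
      (fun l hl => hout _ _ _ (Or.inr (Or.inl hl)))
      (fun l hl hl' => hout _ _ _ (Or.inr (Or.inr (by omega)))) (fun e he => ?_) p (by omega)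
    · simpa only [show (n : ℤ) - 2 * p - γ = q by omega, show p + γ = v by omega] using key
    · rw [← h e (e + γ) (n - 2 * e - γ) (by omega) (by omega) (by omega) (by omega)]
      refine Finset.sum_congr rfl fun m _ => ?_
      congr 2 <;> ring

/-- The unknowns fill a trapezoid. `h1` and `h2` are Hankel systems by weight that settle the two
corners where q or p is at least n + 9, once the middle p, q ≤ n + 8 is known to vanish. The
monomial `h3` and the binomial `h4` clear the middle. -/
theorem eq_zero_of_trapezoid_system (n : ℕ) (hn : 27 ≤ n) (y : ℤ → ℤ → ℤ → k)
    (hout : ∀ v p q, v < 0 ∨ p < 0 ∨ q < 0 ∨ (n : ℤ) + 2 < v → y v p q = 0)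
    (h1 : ∀ e₁ e₂ e₃ : ℤ, 0 ≤ e₁ → 0 ≤ e₂ → 0 ≤ e₃ → e₁ + e₂ + e₃ = n →
      ∑ m ∈ Finset.range (n + 1),
        (m + 1 : k)⁻¹ * y (m - e₁) (m - e₂) (3 * n + 9 - 2 * m - e₃) = 0)
    (h2 : ∀ e₁ e₂ e₃ : ℤ, 0 ≤ e₁ → 0 ≤ e₂ → 0 ≤ e₃ → e₁ + e₂ + e₃ = n →
      ∑ m ∈ Finset.range (n + 1),
        (m + 1 : k)⁻¹ * y (m - e₁) (3 * n + 9 - 2 * m - e₂) (m - e₃) = 0)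
    (h3 : ∀ e₁ e₂ e₃ : ℤ, 0 ≤ e₁ → 0 ≤ e₂ → 0 ≤ e₃ → e₁ + e₂ + e₃ = n →
      y (n + 2 - e₁) (n - 1 - e₂) (n + 8 - e₃) = 0)
    (h4 : ∀ e₁ e₂ e₃ : ℤ, 0 ≤ e₁ → 0 ≤ e₂ → 0 ≤ e₃ → e₁ + e₂ + e₃ = n →
      y (n + 2 - e₁) (n + 8 - e₂) (n - 1 - e₃) +
        y (9 - e₁) (2 * n - 9 - e₂) (n + 9 - e₃) = 0)
    (v p q : ℤ) (hsum : v + p + q = 2 * n + 9) : y v p q = 0 := by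
  -- Divisors of the monomial of `h3`.
  have left : ∀ v p q : ℤ, v + p + q = 2 * n + 9 → p ≤ n - 1 → q ≤ n + 8 → y v p q = 0 := by
    intro v p q hs hp hq
    by_cases ho : v < 0 ∨ p < 0 ∨ q < 0 ∨ (n : ℤ) + 2 < v
    · exact hout v p q ho
    have := h3 (n + 2 - v) (n - 1 - p) (n + 8 - q) (by omega) (by omega) (by omega) (by omega)
    simpa only [sub_sub_cancel] using this
  -- Here v ≤ 9 and p, q ≤ n + 9, so the second term of `h4` is hit. The second index of its partner
  -- is p - n + 17 ≤ 26, which lies in `left` exactly because n ≥ 27.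
  have bottom : ∀ v p q : ℤ, v + p + q = 2 * n + 9 → n ≤ p → n ≤ q → y v p q = 0 := by
    intro v p q hs hp hq
    by_cases ho : v < 0 ∨ p < 0 ∨ q < 0 ∨ (n : ℤ) + 2 < v
    · exact hout v p q ho
    have := h4 (9 - v) (2 * n - 9 - p) (n + 9 - q) (by omega) (by omega) (by omega) (by omega)
    rw [left _ _ _ (by omega) (by omega) (by omega), zero_add] at this
    simpa only [sub_sub_cancel] using this
  -- The first term of `h4` ties a point of this strip to a partner far out in the p-corner.
  have strip : ∀ v p q : ℤ, v + p + q = 2 * n + 9 → n ≤ p → p ≤ n + 8 → q ≤ n - 1 →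
      y (v - n + 7) (p + n - 17) (q + 10) = 0 → y v p q = 0 := by
    intro v p q hs hp hp' hq h
    by_cases ho : v < 0 ∨ p < 0 ∨ q < 0 ∨ (n : ℤ) + 2 < v
    · exact hout v p q ho
    have := h4 (n + 2 - v) (n + 8 - p) (n - 1 - q) (by omega) (by omega) (by omega) (by omega)
    rw [show (9 : ℤ) - (n + 2 - v) = v - n + 7 by ring,
      show (2 * n - 9 : ℤ) - (n + 8 - p) = p + n - 17 by ring,
      show (n + 9 : ℤ) - (n - 1 - q) = q + 10 by ring, h, add_zero] at this
    simpa only [sub_sub_cancel] using this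
  -- Half of the p-corner comes before the strip, avoiding circularity: when v ≤ q, strip points on
  -- the same weight line have v below n - 7, so their partners have negative first index.
  have right : ∀ v p q : ℤ, v + p + q = 2 * n + 9 → n + 9 ≤ p → v ≤ q → y v p q = 0 := by
    intro v p q hs hp hvq
    obtain ⟨γ, hγ⟩ := Int.eq_ofNat_of_zero_le (sub_nonneg.mpr hvq)
    have key := eq_zero_of_hankel_system n γ
      (fun l => y l (2 * n + 9 - 2 * l - γ) (l + γ)) (fun l hl => hout _ _ _ (Or.inl hl))
      (fun l hl hl' => ?_) (fun e he => ?_) v (by omega)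
    · simpa only [show (2 * n + 9 : ℤ) - 2 * v - γ = p by omega, show v + γ = q by omega] using key
    · by_cases ho : l < 0
      · exact hout _ _ _ (Or.inl ho)
      rcases le_or_gt (2 * n + 9 - 2 * l - γ) ((n : ℤ) - 1) with hp' | hp'
      · exact left _ _ _ (by omega) hp' (by omega)
      rcases le_or_gt (n : ℤ) (l + γ) with hq' | hq'
      · exact bottom _ _ _ (by omega) (by omega) hq'
      · exact strip _ _ _ (by omega) (by omega) (by omega) (by omega)
          (hout _ _ _ (Or.inl (by omega)))
    · have := h2 (e + γ) (n - 2 * e - γ) e (by omega) (by omega) (by omega) (by omega)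
      rw [← this]
      refine Finset.sum_congr rfl fun m _ => ?_
      congr 2 <;> ring
  -- The partner of a strip point has first index at most 9 and third at least 10, so it falls under
  -- `right`.
  have middle : ∀ v p q : ℤ, v + p + q = 2 * n + 9 → p ≤ n + 8 → q ≤ n + 8 → y v p q = 0 := by
    intro v p q hs hp hq
    by_cases ho : v < 0 ∨ p < 0 ∨ q < 0 ∨ (n : ℤ) + 2 < v
    · exact hout v p q ho
    rcases le_or_gt p ((n : ℤ) - 1) with hp' | hp'
    · exact left _ _ _ hs hp' hq
    rcases le_or_gt (n : ℤ) q with hq' | hq'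
    · exact bottom _ _ _ hs (by omega) hq'
    · exact strip _ _ _ hs (by omega) hp (by omega)
        (right _ _ _ (by omega) (by omega) (by omega))
  rcases le_or_gt p (n + 8) with hp | hp
  · rcases le_or_gt q (n + 8) with hq | hq
    · exact middle v p q hsum hp hq
    · rcases le_total v p with hvp | hvp
      · obtain ⟨γ, hγ⟩ := Int.eq_ofNat_of_zero_le (sub_nonneg.mpr hvp)
        have key := eq_zero_of_hankel_system n γ
          (fun l => y l (l + γ) (2 * n + 9 - 2 * l - γ)) (fun l hl => hout _ _ _ (Or.inl hl))
          (fun l hl hl' => middle _ _ _ (by omega) (by omega) (by omega)) (fun e he => ?_) v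
          (by omega)
        · simpa only [show (2 * n + 9 : ℤ) - 2 * v - γ = q by omega,
            show v + γ = p by omega] using key
        · have := h1 (e + γ) e (n - 2 * e - γ) (by omega) (by omega) (by omega) (by omega)
          rw [← this]
          refine Finset.sum_congr rfl fun m _ => ?_
          congr 2 <;> ring
      · obtain ⟨γ, hγ⟩ := Int.eq_ofNat_of_zero_le (sub_nonneg.mpr hvp)
        have key := eq_zero_of_hankel_system n γ
          (fun l => y (l + γ) l (2 * n + 9 - 2 * l - γ))
          (fun l hl => hout _ _ _ (Or.inr (Or.inl hl)))
          (fun l hl hl' => middle _ _ _ (by omega) (by omega) (by omega)) (fun e he => ?_) p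
          (by omega)
        · simpa only [show (2 * n + 9 : ℤ) - 2 * p - γ = q by omega,
            show p + γ = v by omega] using key
        · have := h1 e (e + γ) (n - 2 * e - γ) (by omega) (by omega) (by omega) (by omega)
          rw [← this]
          refine Finset.sum_congr rfl fun m _ => ?_
          congr 2 <;> ring
  · rcases le_total v q with hvq | hvq
    · exact right v p q hsum (by omega) hvq
    · obtain ⟨γ, hγ⟩ := Int.eq_ofNat_of_zero_le (sub_nonneg.mpr hvq)
      have key := eq_zero_of_hankel_system n γ
        (fun l => y (l + γ) (2 * n + 9 - 2 * l - γ) l)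
        (fun l hl => hout _ _ _ (Or.inr (Or.inr (Or.inl hl))))
        (fun l hl hl' => middle _ _ _ (by omega) (by omega) (by omega)) (fun e he => ?_) q
        (by omega)
      · simpa only [show (2 * n + 9 : ℤ) - 2 * q - γ = p by omega,
          show q + γ = v by omega] using key
      · have := h2 e (n - 2 * e - γ) (e + γ) (by omega) (by omega) (by omega) (by omega)
        rw [← this]
        refine Finset.sum_congr rfl fun m _ => ?_
        congr 2 <;> ring

end Hankel

/-! ### Sums over multi-indexes -/

section Shift

variable {k : Type*} [Field k] {r : ℕ}

/-- The value of `x` at `J - D`, or `0` if `D ≤ J` fails. -/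
def shiftValue (x : (Fin r →₀ ℕ) → k) (J D : Fin r →₀ ℕ) : k :=
  if D ≤ J then x (J - D) else 0

/-- The function on multi-indexes that is the combination with coefficients `c` of the indicators
of the multi-indexes `J t`, `t ∈ T`. -/
def sparse (T : Finset ℕ) (c : ℕ → k) (J : ℕ → (Fin r →₀ ℕ)) (D : Fin r →₀ ℕ) : k :=
  ∑ t ∈ T, c t * if D = J t then 1 else 0

theorem sparse_eq_zero {T : Finset ℕ} {c : ℕ → k} {J : ℕ → (Fin r →₀ ℕ)} {D : Fin r →₀ ℕ}
    (h : ∀ t ∈ T, D ≠ J t) : sparse T c J D = 0 :=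
  Finset.sum_eq_zero fun t ht => by rw [if_neg (h t ht), mul_zero]

/-- A form with few terms yields an equation with one unknown per term, at the term's exponent minus
the row index. -/
theorem sum_sparse {S : Finset (Fin r →₀ ℕ)} {x : (Fin r →₀ ℕ) → k} (hx : ∀ D ∉ S, x D = 0)
    (T : Finset ℕ) (c : ℕ → k) (J : ℕ → (Fin r →₀ ℕ)) (E : Fin r →₀ ℕ) :
    ∑ D ∈ S, sparse T c J (D + E) * x D = ∑ t ∈ T, c t * shiftValue x (J t) E := by
  simp only [sparse, Finset.sum_mul, mul_assoc]
  rw [Finset.sum_comm]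
  refine Finset.sum_congr rfl fun t _ => ?_
  rw [← Finset.mul_sum, shiftValue]
  congr 1
  split_ifs with h
  · by_cases hS : J t - E ∈ S
    · rw [Finset.sum_eq_single_of_mem _ hS]
      · rw [if_pos (tsub_add_cancel_of_le h), one_mul]
      · intro D _ hD
        rw [if_neg, zero_mul]
        intro h'
        exact hD (eq_tsub_of_add_eq h')
    · rw [hx _ hS]
      refine Finset.sum_eq_zero fun D hD => ?_
      rw [if_neg, zero_mul]
      intro h'
      exact hS (eq_tsub_of_add_eq h' ▸ hD)
  · refine Finset.sum_eq_zero fun D _ => ?_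
    rw [if_neg, zero_mul]
    intro h'
    exact h (h' ▸ le_add_self)

variable {q : ℕ}

/-- The multi-index `(v, p, w, 0, …, 0)`. -/
def triple (q v p w : ℕ) : Fin (q + 3) →₀ ℕ :=
  Finsupp.equivFunOnFinite.symm fun l =>
    if l.val = 0 then v else if l.val = 1 then p else if l.val = 2 then w else 0

theorem triple_apply (v p w : ℕ) (l : Fin (q + 3)) :
    triple q v p w l =
      if l.val = 0 then v else if l.val = 1 then p else if l.val = 2 then w else 0 := rfl

theorem triple_apply_zero (v p w : ℕ) : triple q v p w ⟨0, by omega⟩ = v := rfl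

theorem triple_apply_two (v p w : ℕ) : triple q v p w ⟨2, by omega⟩ = w := rfl

theorem degree_triple (v p w : ℕ) : (triple q v p w).degree = v + p + w := by
  rw [Finsupp.degree_eq_sum, Fin.sum_univ_succ, Fin.sum_univ_succ, Fin.sum_univ_succ]
  simp [triple_apply, add_assoc, Nat.mod_eq_of_lt (by omega : 2 < q + 3)]

theorem triple_le_triple {v p w v' p' w' : ℕ} :
    triple q v p w ≤ triple q v' p' w' ↔ v ≤ v' ∧ p ≤ p' ∧ w ≤ w' := by
  constructor
  · intro h
    exact ⟨h ⟨0, by omega⟩, h ⟨1, by omega⟩, h ⟨2, by omega⟩⟩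
  · rintro ⟨h1, h2, h3⟩ l
    rw [triple_apply, triple_apply]
    split_ifs <;> omega

theorem triple_sub_triple (v p w v' p' w' : ℕ) :
    triple q v p w - triple q v' p' w' = triple q (v - v') (p - p') (w - w') := by
  ext l
  rw [Finsupp.tsub_apply, triple_apply, triple_apply, triple_apply]
  split_ifs <;> rfl

theorem eq_triple {D : Fin (q + 3) →₀ ℕ} (h : ∀ l : Fin (q + 3), 3 ≤ l.val → D l = 0) :
    D = triple q (D ⟨0, by omega⟩) (D ⟨1, by omega⟩) (D ⟨2, by omega⟩) := by
  ext ⟨l, hl⟩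
  rw [triple_apply]
  match l, hl with
  | 0, _ => rfl
  | 1, _ => rfl
  | 2, _ => rfl
  | l + 3, hl => exact h ⟨l + 3, hl⟩ (by simp)

/-- A function on multi-indexes as a function of three integers, extended by zero. -/
def tripleValue (x : (Fin (q + 3) →₀ ℕ) → k) (v p w : ℤ) : k :=
  if 0 ≤ v ∧ 0 ≤ p ∧ 0 ≤ w then x (triple q v.toNat p.toNat w.toNat) else 0

theorem tripleValue_natCast (x : (Fin (q + 3) →₀ ℕ) → k) (v p w : ℕ) :
    tripleValue x v p w = x (triple q v p w) := by
  rw [tripleValue, if_pos ⟨by omega, by omega, by omega⟩]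
  simp

theorem tripleValue_of_neg (x : (Fin (q + 3) →₀ ℕ) → k) {v p w : ℤ}
    (h : v < 0 ∨ p < 0 ∨ w < 0) : tripleValue x v p w = 0 :=
  if_neg (by omega)

theorem shiftValue_triple (x : (Fin (q + 3) →₀ ℕ) → k) (v p w v' p' w' : ℕ) :
    shiftValue x (triple q v p w) (triple q v' p' w') =
      tripleValue x (v - v') (p - p') (w - w') := by
  rw [shiftValue, triple_sub_triple]
  split_ifs with h <;> rw [triple_le_triple] at h
  · rw [← tripleValue_natCast x, Nat.cast_sub h.1, Nat.cast_sub h.2.1, Nat.cast_sub h.2.2]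
  · rw [tripleValue_of_neg]
    omega

end Shift

/-! ### Forms in three variables -/

section ThreeVariables

variable {k : Type*} [Field k] {q : ℕ}

/-- The constraints `(j, j, j, 0, …, 0)`. -/
def ternaryConstraints (j q : ℕ) : List ℕ := [j, j, j] ++ List.replicate q 0

theorem mem_constrained_ternaryConstraints {j e : ℕ} (he : e ≤ j) {D : Fin (q + 3) →₀ ℕ} :
    D ∈ constrained (q + 3) (ternaryConstraints j q) e ↔
      ∃ v p w, v + p + w = e ∧ D = triple q v p w := by
  rw [mem_constrained]
  constructor
  · rintro ⟨hdeg, hD⟩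
    have h := eq_triple (D := D) fun l hl => by
      refine Nat.le_zero.mp (hD l 0 ?_)
      rw [ternaryConstraints, List.getElem?_append_right (by simpa using hl)]
      simp only [List.length_cons, List.length_nil, List.getElem?_replicate]
      rw [if_pos (by omega)]
      rfl
    refine ⟨_, _, _, ?_, h⟩
    rw [← hdeg]
    conv_rhs => rw [h]
    rw [degree_triple]
  · rintro ⟨v, p, w, hsum, rfl⟩
    refine ⟨by rw [degree_triple, hsum], fun ⟨l, hl⟩ t ht => ?_⟩
    rw [triple_apply]
    match l, hl with
    | 0, _ => simp [ternaryConstraints] at ht; simp; omega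
    | 1, _ => simp [ternaryConstraints] at ht; simp; omega
    | 2, _ => simp [ternaryConstraints] at ht; simp; omega
    | l + 3, hl => simp

/-- The shift by a in the first exponent of φ lets one use only the rows `(a + e₁, e₂, e₃)`. These
violate the first bound in P, and they have degree N + a exactly when the eᵢ sum to N, which is the
triangle system. -/
theorem hasInjectiveForm_ternary [CharZero k] {P : List ℕ} {a N j : ℕ} (hP : P[0]? = some (a - 1))
    (ha : 1 ≤ a) (hj : j = N + a + N) :
    HasInjectiveForm k (q + 3) P (ternaryConstraints j q) (N + a) N := by
  refine ⟨sparse (Finset.range (N + 1)) (fun m => (m + 1 : k)⁻¹)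
    (fun m => triple q (m + a) m (2 * N - 2 * m)), fun J hJ => sparse_eq_zero ?_, ?_⟩
  · rintro m hm rfl
    rw [Finset.mem_range] at hm
    exact hJ ((mem_constrained_ternaryConstraints (by omega)).mpr ⟨_, _, _, by omega, rfl⟩)
  intro x hx hrow E hE
  obtain ⟨v, p, w, hsum, rfl⟩ := (mem_constrained_ternaryConstraints (by omega)).mp hE
  rw [← tripleValue_natCast x]
  refine eq_zero_of_triangle_system N _ (fun _ _ _ => tripleValue_of_neg x) ?_ _ _ _ (by omega)
  intro e₁ e₂ e₃ h₁ h₂ h₃ hsum'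
  lift e₁ to ℕ using h₁
  lift e₂ to ℕ using h₂
  lift e₃ to ℕ using h₃
  have h := hrow (triple q (a + e₁) e₂ e₃)
    (mem_constrained.mpr ⟨by rw [degree_triple]; omega, by simp⟩) fun hmem => by
      have := (mem_constrained.mp hmem).2 ⟨0, by omega⟩ (a - 1) hP
      rw [triple_apply_zero] at this
      omega
  simp only [add_comm (triple q (a + e₁) e₂ e₃)] at h
  rw [sum_sparse hx] at h
  rw [← h]
  refine Finset.sum_congr rfl fun m hm => ?_
  rw [Finset.mem_range] at hm
  rw [shiftValue_triple]
  congr 2 <;> omega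

/-- Dually, a functional orthogonal to all derivatives of the four forms solves the trapezoid
system. Forms beyond the fourth are 0, so any s ≥ 4 works. -/
theorem hasSpanningForms_three [CharZero k] {n s : ℕ} (hn : 27 ≤ n) (hs : 4 ≤ s) :
    HasSpanningForms k 3 [n + 2] (2 * n + 9) n s := by
  have hmem : ∀ {D : Fin 3 →₀ ℕ} {d : ℕ}, D ∈ constrained 3 [n + 2] d ↔
      ∃ v p w, v + p + w = d ∧ v ≤ n + 2 ∧ D = triple 0 v p w := by
    intro D d
    rw [mem_constrained]
    constructor
    · rintro ⟨hdeg, hD⟩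
      have h := eq_triple (q := 0) (D := D) fun l hl => absurd l.2 (by omega)
      refine ⟨_, _, _, ?_, hD 0 (n + 2) rfl, h⟩
      rw [← hdeg]
      conv_rhs => rw [h]
      rw [degree_triple]
      rfl
    · rintro ⟨v, p, w, hsum, hv, rfl⟩
      refine ⟨by rw [degree_triple, hsum], fun ⟨l, hl⟩ t ht => ?_⟩
      match l, hl with
      | 0, _ =>
        simp at ht
        subst ht
        exact hv
      | l + 1, _ => simp at ht
  have key : ∀ g : ℕ → (Fin 3 →₀ ℕ) → k,
      g 0 = sparse (Finset.range (n + 1)) (fun m => (m + 1 : k)⁻¹)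
        (fun m => triple 0 m m (3 * n + 9 - 2 * m)) →
      g 1 = sparse (Finset.range (n + 1)) (fun m => (m + 1 : k)⁻¹)
        (fun m => triple 0 m (3 * n + 9 - 2 * m) m) →
      g 2 = sparse {0} 1 (fun _ => triple 0 (n + 2) (n - 1) (n + 8)) →
      g 3 = sparse (Finset.range 2) 1
        (fun m => if m = 0 then triple 0 (n + 2) (n + 8) (n - 1)
          else triple 0 9 (2 * n - 9) (n + 9)) →
      (∀ m, 4 ≤ m → g m = 0) → HasSpanningForms k 3 [n + 2] (2 * n + 9) n s := by
    intro g h0 h1 h2 h3 h4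
    refine ⟨fun m => g m, fun m J hJ => ?_, ?_⟩
    · obtain ⟨m, hm⟩ := m
      simp only
      match m with
      | 0 =>
        rw [h0]
        refine sparse_eq_zero ?_
        rintro t ht rfl
        rw [Finset.mem_range] at ht
        exact hJ (hmem.mpr ⟨_, _, _, by omega, by omega, rfl⟩)
      | 1 =>
        rw [h1]
        refine sparse_eq_zero ?_
        rintro t ht rfl
        rw [Finset.mem_range] at ht
        exact hJ (hmem.mpr ⟨_, _, _, by omega, by omega, rfl⟩)
      | 2 =>
        rw [h2]
        refine sparse_eq_zero ?_
        rintro t ht rfl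
        exact hJ (hmem.mpr ⟨_, _, _, by omega, by omega, rfl⟩)
      | 3 =>
        rw [h3]
        refine sparse_eq_zero ?_
        rintro t ht rfl
        refine hJ (hmem.mpr ?_)
        split_ifs
        · exact ⟨_, _, _, by omega, by omega, rfl⟩
        · exact ⟨_, _, _, by omega, by omega, rfl⟩
      | m + 4 => rw [h4 _ (by omega), Pi.zero_apply]
    intro x hx hrow D hD
    obtain ⟨v, p, w, hsum, hv, rfl⟩ := hmem.mp hD
    rw [← tripleValue_natCast x]
    -- Operators of order n satisfy the bound n + 2 automatically, so every ternary exponent is an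
    -- admissible row.
    have hrow' : ∀ m (hm : m < s) (e₁ e₂ e₃ : ℕ), e₁ + e₂ + e₃ = n →
        ∑ D ∈ constrained 3 [n + 2] (2 * n + 9), g m (D + triple 0 e₁ e₂ e₃) * x D = 0 :=
      fun m hm e₁ e₂ e₃ he =>
        hrow ⟨m, hm⟩ _ (hmem.mpr ⟨_, _, _, he, by omega, rfl⟩)
    refine eq_zero_of_trapezoid_system n hn _ ?_ ?_ ?_ ?_ ?_ _ _ _ (by omega)
    · intro v p w h
      by_cases hneg : v < 0 ∨ p < 0 ∨ w < 0
      · exact tripleValue_of_neg x hneg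
      · lift v to ℕ using by omega
        lift p to ℕ using by omega
        lift w to ℕ using by omega
        rw [tripleValue_natCast]
        refine hx _ fun hcon => ?_
        have := (mem_constrained.mp hcon).2 0 (n + 2) rfl
        have h0 : triple 0 v p w 0 = v := rfl
        omega
    all_goals
      intro e₁ e₂ e₃ h₁ h₂ h₃ hsum'
      lift e₁ to ℕ using h₁
      lift e₂ to ℕ using h₂
      lift e₃ to ℕ using h₃
    · have h := hrow' 0 (by omega) e₁ e₂ e₃ (by omega)
      rw [h0, sum_sparse hx] at h
      rw [← h]
      refine Finset.sum_congr rfl fun m hm => ?_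
      rw [Finset.mem_range] at hm
      rw [shiftValue_triple]
      congr 2; omega
    · have h := hrow' 1 (by omega) e₁ e₂ e₃ (by omega)
      rw [h1, sum_sparse hx] at h
      rw [← h]
      refine Finset.sum_congr rfl fun m hm => ?_
      rw [Finset.mem_range] at hm
      rw [shiftValue_triple]
      congr 2; omega
    · have h := hrow' 2 (by omega) e₁ e₂ e₃ (by omega)
      rw [h2, sum_sparse hx, Finset.sum_singleton, Pi.one_apply, one_mul, shiftValue_triple] at h
      rw [← h]
      congr 1 <;> omega
    · have h := hrow' 3 (by omega) e₁ e₂ e₃ (by omega)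
      rw [h3, sum_sparse hx, Finset.sum_range_succ, Finset.sum_range_one, Pi.one_apply, one_mul,
        Pi.one_apply, one_mul, if_pos rfl, if_neg one_ne_zero, shiftValue_triple,
        shiftValue_triple] at h
      rw [← h]
      congr 2 <;> omega
  exact key (fun m => match m with
    | 0 => _
    | 1 => _
    | 2 => _
    | 3 => _
    | _ + 4 => 0) rfl rfl rfl rfl fun m hm => by
      obtain ⟨m, rfl⟩ := Nat.exists_eq_add_of_le' hm
      rfl

end ThreeVariables

/-! ### Forms that are divisible by a monomial -/

section Box

variable {k : Type*} [Field k] {q b : ℕ}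

theorem mem_constrained_replicate {d : ℕ} {D : Fin (q + 3) →₀ ℕ} :
    D ∈ constrained (q + 3) (List.replicate (q + 1) b) d ↔
      D.degree = d ∧ ∀ l : Fin (q + 3), l.val < q + 1 → D l ≤ b := by
  rw [mem_constrained]
  refine and_congr_right fun _ => forall_congr' fun l => ?_
  rw [List.getElem?_replicate]
  split_ifs with h <;> simp [h]

/-- The multi-index `(f 0, …, f q, u, v)`. -/
def boxIndex (f : Fin (q + 1) → ℕ) (u v : ℕ) : Fin (q + 3) →₀ ℕ :=
  Finsupp.equivFunOnFinite.symm (Fin.snoc (Fin.snoc f u : Fin (q + 2) → ℕ) v)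

theorem boxIndex_castSucc_castSucc (f : Fin (q + 1) → ℕ) (u v : ℕ) (l : Fin (q + 1)) :
    boxIndex f u v l.castSucc.castSucc = f l := by
  simp [boxIndex]

theorem boxIndex_castSucc_last (f : Fin (q + 1) → ℕ) (u v : ℕ) :
    boxIndex f u v (Fin.last (q + 1)).castSucc = u := by
  simp [boxIndex]

theorem boxIndex_last (f : Fin (q + 1) → ℕ) (u v : ℕ) :
    boxIndex f u v (Fin.last (q + 2)) = v := by
  simp [boxIndex]

theorem degree_eq_box (D : Fin (q + 3) →₀ ℕ) :
    D.degree = ∑ l : Fin (q + 1), D l.castSucc.castSucc + D (Fin.last (q + 1)).castSucc +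
      D (Fin.last (q + 2)) := by
  rw [Finsupp.degree_eq_sum, Fin.sum_univ_castSucc, Fin.sum_univ_castSucc]

theorem degree_boxIndex (f : Fin (q + 1) → ℕ) (u v : ℕ) :
    (boxIndex f u v).degree = ∑ l, f l + u + v := by
  rw [degree_eq_box, boxIndex_last, boxIndex_castSucc_last]
  simp only [boxIndex_castSucc_castSucc]

theorem forall_box {p : Fin (q + 3) → Prop} :
    (∀ l, p l) ↔ (∀ l : Fin (q + 1), p l.castSucc.castSucc) ∧
      p (Fin.last (q + 1)).castSucc ∧ p (Fin.last (q + 2)) := by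
  rw [Fin.forall_fin_succ', Fin.forall_fin_succ', and_assoc]

theorem mem_constrained_box {d : ℕ} {D : Fin (q + 3) →₀ ℕ} :
    D ∈ constrained (q + 3) (List.replicate (q + 1) b) d ↔
      D.degree = d ∧ ∀ l : Fin (q + 1), D l.castSucc.castSucc ≤ b := by
  rw [mem_constrained_replicate, forall_box]
  simp [fun l : Fin (q + 1) => Nat.lt_succ_iff.mp l.2]

/-- The two monomials have all constrained exponents equal to b and free exponents (w, d) and (d,
w). Every constrained monomial of degree d divides one of them, and the quotient, of degree e, is
the operator that isolates it. -/
theorem hasSpanningForms_box {d e w s : ℕ} (hs : 2 ≤ s) (he : (q + 1) * b + w = e)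
    (hd : d ≤ 2 * w + 1) :
    HasSpanningForms k (q + 3) (List.replicate (q + 1) b) d e s := by
  have hsum : ∀ u v, (boxIndex (fun _ : Fin (q + 1) => b) u v).degree = (q + 1) * b + u + v := by
    intro u v
    rw [degree_boxIndex]
    simp
  have hmem : ∀ u v, u + v = w + d → boxIndex (fun _ : Fin (q + 1) => b) u v ∈
      constrained (q + 3) (List.replicate (q + 1) b) (d + e) := by
    intro u v huv
    refine mem_constrained_box.mpr ⟨by rw [hsum]; omega, fun l => ?_⟩
    rw [boxIndex_castSucc_castSucc]
  have hle : ∀ {D : Fin (q + 3) →₀ ℕ} {u v : ℕ},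
      D ∈ constrained (q + 3) (List.replicate (q + 1) b) d →
      D (Fin.last (q + 1)).castSucc ≤ u → D (Fin.last (q + 2)) ≤ v →
      D ≤ boxIndex (fun _ : Fin (q + 1) => b) u v := by
    intro D u v hD hu hv
    refine forall_box.mpr ⟨fun l => ?_, ?_, ?_⟩
    · rw [boxIndex_castSucc_castSucc]
      exact (mem_constrained_box.mp hD).2 l
    · rwa [boxIndex_castSucc_last]
    · rwa [boxIndex_last]
  refine ⟨fun m => if m.val = 0 then sparse {0} 1 (fun _ => boxIndex (fun _ => b) w d)
    else sparse {0} 1 (fun _ => boxIndex (fun _ => b) d w), fun m J hJ => ?_, ?_⟩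
  · dsimp only
    split_ifs
    · refine sparse_eq_zero ?_
      rintro t - rfl
      exact hJ (hmem _ _ rfl)
    · refine sparse_eq_zero ?_
      rintro t - rfl
      exact hJ (hmem _ _ (add_comm d w))
  intro x hx hrow D hD
  have hkill : ∀ m : Fin s, ∀ u v, u + v = w + d →
      (if m.val = 0 then sparse {0} 1 (fun _ => boxIndex (fun _ => b) w d)
        else sparse {0} 1 (fun _ => boxIndex (fun _ => b) d w)) =
          sparse {0} (1 : ℕ → k) (fun _ => boxIndex (fun _ : Fin (q + 1) => b) u v) →
      D (Fin.last (q + 1)).castSucc ≤ u → D (Fin.last (q + 2)) ≤ v → x D = 0 := by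
    intro m u v huv hm hu hv
    have hDle := hle hD hu hv
    have hdeg : (boxIndex (fun _ : Fin (q + 1) => b) u v - D).degree = e := by
      have h := hsum u v
      rw [← tsub_add_cancel_of_le hDle, map_add, (mem_constrained.mp hD).1] at h
      omega
    have h := hrow m (boxIndex (fun _ => b) u v - D)
      (mem_constrained_of_le (hmem u v huv) hdeg tsub_le_self)
    simp only [hm] at h
    rw [sum_sparse hx, Finset.sum_singleton, Pi.one_apply, one_mul, shiftValue,
      if_pos tsub_le_self, tsub_tsub_cancel_of_le hDle] at h
    exact h
  have hdeg := (mem_constrained.mp hD).1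
  rw [degree_eq_box] at hdeg
  -- If the first free exponent exceeds w, the second is at most d - w - 1 ≤ w.
  rcases le_or_gt (D (Fin.last (q + 1)).castSucc) w with h | h
  · exact hkill ⟨0, by omega⟩ w d rfl (if_pos rfl) h (by omega)
  · exact hkill ⟨1, by omega⟩ d w (add_comm d w) (if_neg one_ne_zero) (by omega) (by omega)

end Box

/-! ### Numbers of constrained monomials -/

section Counting

/-- Multiplication by the variable z is a bijection onto the constrained monomials divisible by z.
-/
theorem card_constrained_succ {r e : ℕ} {K : List ℕ} {z : Fin r}
    (hz : ∀ t ∈ K[(z : ℕ)]?, e + 1 ≤ t) :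
    (constrained r K (e + 1)).card =
      (constrained r K e).card + {D ∈ constrained r K (e + 1) | D z = 0}.card := by
  rw [← Finset.card_filter_add_card_filter_not (s := constrained r K (e + 1)) (fun D => D z = 0),
    add_comm]
  congr 1
  refine (Finset.card_bij (fun D _ => D + Finsupp.single z 1) ?_ ?_ ?_).symm
  · intro D hD
    rw [mem_constrained] at hD
    rw [Finset.mem_filter, mem_constrained, map_add, hD.1, Finsupp.degree_single]
    refine ⟨⟨rfl, fun l t ht => ?_⟩, by simp⟩
    by_cases hl : l = z
    · subst hl
      refine le_trans ?_ (hz t ht)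
      have := Finsupp.le_degree l D
      simp only [Finsupp.add_apply, Finsupp.single_eq_same]
      omega
    · simpa [Finsupp.single_apply, Ne.symm hl] using hD.2 l t ht
  · intro D _ D' _ h
    exact add_right_cancel h
  · intro D hD
    rw [Finset.mem_filter] at hD
    have hle : Finsupp.single z 1 ≤ D := by
      rw [Finsupp.single_le_iff]
      exact Nat.one_le_iff_ne_zero.mpr hD.2
    refine ⟨D - Finsupp.single z 1, mem_constrained_of_le hD.1 ?_ tsub_le_self,
      tsub_add_cancel_of_le hle⟩
    have h := (mem_constrained.mp hD.1).1
    rw [← tsub_add_cancel_of_le hle, map_add, Finsupp.degree_single] at h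
    omega

theorem card_constrained_replicate_succ {q b e : ℕ} (he : (q + 1) * b ≤ e + 1) :
    (constrained (q + 3) (List.replicate (q + 1) b) (e + 1)).card =
      (constrained (q + 3) (List.replicate (q + 1) b) e).card + (b + 1) ^ (q + 1) := by
  rw [card_constrained_succ (z := Fin.last (q + 2)) (by simp)]
  congr 1
  have hcard : (Fintype.piFinset fun _ : Fin (q + 1) => Finset.range (b + 1)).card =
      (b + 1) ^ (q + 1) := by simp
  rw [← hcard]
  have hsum : ∀ f ∈ Fintype.piFinset fun _ : Fin (q + 1) => Finset.range (b + 1),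
      ∑ l, f l ≤ e + 1 := by
    intro f hf
    refine (Finset.sum_le_card_nsmul _ _ b fun l _ => ?_).trans (by simpa using he)
    exact Nat.lt_succ_iff.mp (Finset.mem_range.mp (Fintype.mem_piFinset.mp hf l))
  -- The other free exponent absorbs the remaining degree; `hsum` keeps the subtraction from
  -- truncating, so every point of the box occurs.
  refine Finset.card_bij' (fun D _ l => D l.castSucc.castSucc)
    (fun f _ => boxIndex f (e + 1 - ∑ l, f l) 0) ?_ ?_ ?_ ?_
  · intro D hD
    rw [Finset.mem_filter, mem_constrained_box] at hD
    rw [Fintype.mem_piFinset]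
    intro l
    exact Finset.mem_range.mpr (Nat.lt_succ_iff.mpr (hD.1.2 l))
  · intro f hf
    rw [Finset.mem_filter, mem_constrained_box, degree_boxIndex]
    refine ⟨⟨?_, fun l => ?_⟩, boxIndex_last _ _ _⟩
    · have := hsum f hf
      omega
    · rw [boxIndex_castSucc_castSucc]
      exact Nat.lt_succ_iff.mp (Finset.mem_range.mp (Fintype.mem_piFinset.mp hf l))
  · intro D hD
    rw [Finset.mem_filter, mem_constrained_box, degree_eq_box] at hD
    refine DFunLike.ext _ _ (forall_box.mpr ⟨fun l => ?_, ?_, ?_⟩)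
    · rw [boxIndex_castSucc_castSucc]
    · rw [boxIndex_castSucc_last]
      dsimp only
      omega
    · rw [boxIndex_last, hD.2]
  · intro f _
    ext l
    rw [boxIndex_castSucc_castSucc]

theorem card_constrained_ternary_succ {q j e : ℕ} (he : e + 1 ≤ j) :
    (constrained (q + 3) (ternaryConstraints j q) (e + 1)).card =
      (constrained (q + 3) (ternaryConstraints j q) e).card + (e + 2) := by
  rw [card_constrained_succ (z := ⟨2, by omega⟩) (by simpa [ternaryConstraints] using he)]
  congr 1
  rw [← Finset.card_range (e + 2)]
  refine (Finset.card_bij (fun t _ => triple q t (e + 1 - t) 0) ?_ ?_ ?_).symm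
  · intro t ht
    rw [Finset.mem_range] at ht
    rw [Finset.mem_filter, mem_constrained_ternaryConstraints he]
    exact ⟨⟨_, _, _, by omega, rfl⟩, rfl⟩
  · intro t _ t' _ h
    have := DFunLike.congr_fun h ⟨0, by omega⟩
    rwa [triple_apply_zero, triple_apply_zero] at this
  · intro D hD
    rw [Finset.mem_filter, mem_constrained_ternaryConstraints he] at hD
    obtain ⟨⟨v, p, w, hsum, rfl⟩, hw⟩ := hD
    rw [triple_apply_two] at hw
    subst hw
    refine ⟨v, Finset.mem_range.mpr (by omega), ?_⟩
    congr 1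
    omega

theorem le_card_constrained_replicate {q b j s : ℕ} (hs : s ≤ j + 1) :
    s ≤ (constrained (q + 3) (List.replicate (q + 1) b) j).card := by
  rw [← Finset.card_range s]
  refine Finset.card_le_card_of_injOn (fun t => boxIndex (fun _ => 0) t (j - t)) ?_ ?_
  · intro t ht
    rw [Finset.mem_coe, Finset.mem_range] at ht
    refine mem_constrained_box.mpr ⟨?_, fun l => ?_⟩
    · rw [degree_boxIndex]
      simp
      omega
    · rw [boxIndex_castSucc_castSucc]
      exact Nat.zero_le b
  · intro t _ t' _ h
    have := DFunLike.congr_fun h (Fin.last (q + 1)).castSucc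
    simpa only [boxIndex_castSucc_last] using this

end Counting

/-! ### The three families -/

/-- All three families at once, with q + 1 equal bounds a - 1 and i = N + a. Only the spanning forms
depend on the codimension; `hle` makes the growth of m_P equal to N in the degrees concerned. -/
theorem forGeneral_family {k : Type*} [Field k] [CharZero k] {q a N s : ℕ}
    (hN : N = a ^ (q + 1)) (hN3 : 3 ≤ N) (ha : 2 ≤ a) (hle : (q + 1) * (a - 1) ≤ N) (hs : s ≤ a)
    (hspan : HasSpanningForms k (q + 3) (List.replicate (q + 1) (a - 1)) (N + a + 3) (N - 3) s) :
    IsSufficient (q + 3) (N + a + N) (List.replicate (q + 1) (a - 1)) (N + a + 3) s ∧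
      ForGeneral fun c : PairIndex (q + 3) (N + a + N) (List.replicate (q + 1) (a - 1))
          (ternaryConstraints (N + a + N) q) s → k =>
        IsNonUnimodalLevel (q + 3) (pairIdeal c) (s + 1) := by
  have hP : ∀ e, N ≤ e + 1 →
      (constrained (q + 3) (List.replicate (q + 1) (a - 1)) (e + 1)).card =
        (constrained (q + 3) (List.replicate (q + 1) (a - 1)) e).card + N := by
    intro e he
    rw [card_constrained_replicate_succ (hle.trans he), Nat.sub_add_cancel (by omega), hN]
  have hQ : ∀ e, e + 1 ≤ N →
      (constrained (q + 3) (ternaryConstraints (N + a + N) q) (e + 1)).card =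
        (constrained (q + 3) (ternaryConstraints (N + a + N) q) e).card + (e + 2) :=
    fun e he => card_constrained_ternary_succ (by omega)
  obtain ⟨n, rfl⟩ := Nat.exists_eq_add_of_le' hN3
  refine forGeneral_isNonUnimodalLevel (z := Fin.last (q + 2)) (x := ⟨2, by omega⟩) hN3
    (by simp) ?_ ?_ ?_ ?_ ?_ ?_ ?_ hspan (hasInjectiveForm_ternary (by simp) (by omega) rfl)
  · simp [ternaryConstraints]
  · intro t ht
    rw [List.eq_of_mem_replicate ht]
    omega
  · rw [hP _ (by omega)]
  · rw [hP (n + 3 + a + 2) (by omega), hP (n + 3 + a + 1) (by omega)]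
    omega
  · have h := hQ (n + 2) (by omega)
    rw [show n + 3 - 1 = n + 2 by omega, h]
    omega
  · have h := hQ (n + 1) (by omega)
    have h' := hQ n (by omega)
    rw [show n + 3 - 1 = n + 2 by omega, show n + 3 - 3 = n by omega, h, h']
    omega
  · exact le_card_constrained_replicate (by omega)

end

end LevelAlg

/-! ### Choice of parameters -/

theorem mainTheorem2 (k : Type*) [Field k] [IsAlgClosed k] [CharZero k] :
    (∀ t : ℕ, 5 ≤ t →
      (∃ I : Ideal (MvPolynomial (Fin 3) k), LevelAlg.IsNonUnimodalLevel 3 I t) ∧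
      ∃ a i s : ℕ, LevelAlg.F1Params a i s ∧
        LevelAlg.ForGeneral (fun c : LevelAlg.F1Index a i s → k =>
          LevelAlg.IsNonUnimodalLevel 3 (LevelAlg.pairIdeal c) t)) ∧
    (∀ t : ℕ, 3 ≤ t →
      (∃ I : Ideal (MvPolynomial (Fin 4) k), LevelAlg.IsNonUnimodalLevel 4 I t) ∧
      ∃ a b i s : ℕ, LevelAlg.G1Params a b i s ∧
        LevelAlg.ForGeneral (fun c : LevelAlg.G1Index a b i s → k =>
          LevelAlg.IsNonUnimodalLevel 4 (LevelAlg.pairIdeal c) t)) ∧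
    (∀ t : ℕ, 3 ≤ t →
      (∃ I : Ideal (MvPolynomial (Fin 5) k), LevelAlg.IsNonUnimodalLevel 5 I t) ∧
      ∃ a b c i s : ℕ, LevelAlg.H1Params a b c i s ∧
        LevelAlg.ForGeneral (fun x : LevelAlg.H1Index a b c i s → k =>
          LevelAlg.IsNonUnimodalLevel 5 (LevelAlg.pairIdeal x) t)) := by
  refine ⟨fun t ht => ?_, fun t ht => ?_, fun t ht => ?_⟩
  · obtain ⟨s, rfl⟩ := Nat.exists_eq_add_of_le' (by omega : 1 ≤ t)
    -- This gives n ≥ 27 for the trapezoid and s ≤ a = n + 3. With N = a and i = 2a, degree i + 3 is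
    -- 2n + 9 and order N - 3 is n.
    obtain ⟨n, hn⟩ : ∃ n, n = s + 27 := ⟨_, rfl⟩
    have hspan := LevelAlg.hasSpanningForms_three (k := k) (n := n) (s := s) (by omega) (by omega)
    rw [show 2 * n + 9 = n + 3 + (n + 3) + 3 by ring] at hspan
    obtain ⟨h, h'⟩ := LevelAlg.forGeneral_family (k := k) (q := 0) (a := n + 3) (N := n + 3)
      (s := s) (by ring) (by omega) (by omega) (by omega) (by omega) hspan
    obtain ⟨c, hc⟩ := LevelAlg.exists_of_forGeneral h'
    exact ⟨⟨_, hc⟩, n + 3, n + 3 + (n + 3), s, ⟨by omega, by omega, h⟩, h'⟩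
  · obtain ⟨s, rfl⟩ := Nat.exists_eq_add_of_le' (by omega : 1 ≤ t)
    obtain ⟨a, ha⟩ : ∃ a, a = s + 9 := ⟨_, rfl⟩
    -- A linear lower bound on a², enough for d ≤ 2w + 1, that is a² + a + 3 ≤ 2a² - 4a - 1.
    have haa : 9 * a ≤ a * a := Nat.mul_le_mul_right a (by omega)
    have hspan := LevelAlg.hasSpanningForms_box (k := k) (q := 1) (b := a - 1)
      (d := a * a + a + 3) (e := a * a - 3) (w := a * a - 3 - 2 * (a - 1)) (s := s) (by omega)
      (by omega) (by omega)
    obtain ⟨h, h'⟩ := LevelAlg.forGeneral_family (k := k) (q := 1) (a := a) (N := a * a)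
      (s := s) (by ring) (by omega) (by omega) (by omega) (by omega) hspan
    obtain ⟨c, hc⟩ := LevelAlg.exists_of_forGeneral h'
    exact ⟨⟨_, hc⟩, a, a, a * a + a, s, ⟨by omega, le_rfl, by omega, h⟩, h'⟩
  · obtain ⟨s, rfl⟩ := Nat.exists_eq_add_of_le' (by omega : 1 ≤ t)
    obtain ⟨a, ha⟩ : ∃ a, a = s + 9 := ⟨_, rfl⟩
    -- As in codimension 4, a linear bound on a³ suffices for d ≤ 2w + 1.
    have haa : 81 * a ≤ a * a * a :=
      Nat.mul_le_mul_right a (Nat.mul_le_mul (by omega : 9 ≤ a) (by omega : 9 ≤ a))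
    have hspan := LevelAlg.hasSpanningForms_box (k := k) (q := 2) (b := a - 1)
      (d := a * a * a + a + 3) (e := a * a * a - 3) (w := a * a * a - 3 - 3 * (a - 1)) (s := s)
      (by omega) (by omega) (by omega)
    obtain ⟨h, h'⟩ := LevelAlg.forGeneral_family (k := k) (q := 2) (a := a) (N := a * a * a)
      (s := s) (by ring) (by omega) (by omega) (by omega) (by omega) hspan
    obtain ⟨c, hc⟩ := LevelAlg.exists_of_forGeneral h'
    exact ⟨⟨_, hc⟩, a, a, a, a * a * a + a, s, ⟨by omega, le_rfl, le_rfl, by omega, h⟩, h'⟩
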